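/- Let $p\ge 1$ and $q\ge 0$ be coprime integers and let $b=(b_n)_{n\ge1}$ be complex numbers (the background) with $b_{p+q}\neq 0$ and $b_n=0$ for $n>p+q$. Let $\alpha_k$ ($k\in\mathbb Z$) be the oscillators $[\alpha_k,\alpha_l]=k\,\delta_{k+l,0}$ of the free boson $\phi(\lambda)$, let $\zeta=\lambda^p$, $\varphi_a(\zeta)=\phi(e^{2\pi i a/p}\lambda)$ ($a=0,\dots,p-1$), so that $\partial\varphi_0(\zeta)=\frac1p\sum_k\alpha_k\zeta^{-k/p-1}$, and let $$W^s(\zeta)=\sum_{a=0}^{p-1}:\!e^{-\varphi_a(\zeta)}\,\partial^s e^{\varphi_a(\zeta)}\!:\;=\sum_{n\in\mathbb Z}W^s_n\,\zeta^{-n-s}\qquad(s=1,2,\dots)$$ be the $W_{1+\infty}$ currents, $:\ :$ being the normal ordering for the $SL(2,\mathbb C)$-invariant vacuum of the $\zeta$-plane. Let $|\Phi\rangle$ be a state of vanishing fermion number, given by its normalised generating function $Z(j)=\langle b/g|e^{\sum_{n\ge1}j_n\alpha_n}|\Phi\rangle/\langle b/g|\Phi\rangle=e^{F(j;g)}$,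 a formal power series in $j_1,j_2,\dots$ over $\mathbb C((g))$; here $\langle b/g|=\langle 0|e^{g^{-1}\sum_n b_n\alpha_n}$, so $\alpha_n$ acts as $\partial/\partial j_n$, $\alpha_{-n}$ as multiplication by $n(b_n/g+j_n)$ ($n\ge1$), and $\alpha_0$ as $0$. Assume that $F$ has a genus expansion: $F(0;g)=0$ and the coefficient in $F$ of every monomial of degree $N\ge 1$ in the $j_n$ only contains the powers $g^{2h+N-2}$, $h=0,1,2,\dots$. Write $\langle\langle X\rangle\rangle=\langle b/g|\,\mathrm T^*X\,|\Phi\rangle/\langle b/g|\Phi\rangle$ with $\mathrm T^*$ the radial ordering, $\langle X\rangle=\langle b/g|X|\Phi\rangle/\langle b/g|\Phi\rangle$ for a single operator $X$, and $\langle\langle W^s(\zeta_1)W^t(\zeta_2)\rangle\rangle_c=\langle\langle W^s(\zeta_1)W^t(\zeta_2)\rangle\rangle-\langle W^s(\zeta_1)\rangle\langle W^t(\zeta_2)\rangle$. Expand it as a double series $\sum_{M,N\in\mathbb Z}\widehat W^{s,t\,(i)}_{M,N}\,\zeta_1^M\zeta_2^N$ in the regions $i=\mathrm I$: $|\zeta_1|>|\zeta_2|$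 and $i=\mathrm{II}$: $|\zeta_2|>|\zeta_1|$, and let $W^{s,t\,(i)}_{M,N}$ be the coefficient of $g^{2-s-t}$ in $\widehat W^{s,t\,(i)}_{M,N}$ (the weak coupling limit). Consider the conditions - (W1) $W^{s,t\,(\mathrm I)}_{M,N}=0$ unless $N\ge0$ and $M+N\ge-2$; - (W2) $W^{s,t\,(\mathrm{II})}_{M,N}=0$ unless $M\ge0$ and $M+N\ge-2$. (1) Necessity. If $|\Phi\rangle$ satisfies the $W_{1+\infty}$ constraints $W^s_n|\Phi\rangle=0$ for all $s\ge1$, $n\ge-s+1$, then (W1) and (W2) hold for all $s,t\ge1$; moreover, to all orders in $g$, $\widehat W^{s,t\,(\mathrm I)}_{M,N}=0$ for $N<0$ and $\widehat W^{s,t\,(\mathrm{II})}_{M,N}=0$ for $M<0$. (2) Sufficiency. (W1) and (W2) hold for all $s,t\ge1$ if and only if the $W_{1+\infty}$ constraints hold in the weak coupling limit for disk and annulus amplitudes, that is, for all $t\ge1$, $n\ge-t+1$ the coefficient of $g^{-t}$ in $\langle W^t_n\rangle$ vanishes, and for all $k\ge1$ the coefficient of $g^{1-t}$ in $\langle\alpha_kW^t_n\rangle-\langle\alpha_k\rangle\langle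 W^t_n\rangle$ vanishes. (No constraint on $|\Phi\rangle$ is assumed in (2).) -/

import Mathlib

open scoped Nat

noncomputable section

namespace MinimalString

/-- Formal Laurent series in the string coupling `g`. -/
abbrev Coupling : Type := LaurentSeries ℂ

/-- Formal power series in the sources `j₁, j₂, …`, with coefficients in `ℂ((g))`.
A fermion state `|Φ⟩` of vanishing fermion number is represented, relative to a background
`b = (bₙ)`, by the series `Z(j) = ⟨b/g| exp (∑ jₙ αₙ) |Φ⟩ / ⟨b/g|Φ⟩`, i.e. by its `τ` function
`τ(x) = ⟨x/g|Φ⟩` expanded around `x = b` with `xₙ / g = bₙ / g + jₙ` and normalised there. -/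
abbrev Sources : Type := MvPowerSeries ℕ+ Coupling

/-- The oscillators `αₖ` in this representation, for `n ≥ 1`: `αₙ` acts as `∂/∂jₙ`,
`α₋ₙ` acts as multiplication by `n xₙ / g = n (bₙ / g + jₙ)`, and `α₀` acts as `0`
(vanishing fermion number). -/
def alpha (b : ℕ+ → ℂ) : ℤ → Module.End Coupling Sources
  | Int.ofNat 0 => 0
  | Int.ofNat (n + 1) => (MvPowerSeries.pderiv Coupling n.succPNat).toLinearMap
  | Int.negSucc n =>
      Algebra.lmul Coupling Sources
        ((n.succPNat : ℕ) •
          (MvPowerSeries.C (HahnSeries.single (-1 : ℤ) (b n.succPNat)) +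
            MvPowerSeries.X n.succPNat))

/-- The normal ordered product of the oscillators `α_{k₁}, …, α_{k_r}` with respect to the
Dirac vacuum `|0⟩` : creation operators stand to the left of annihilation operators. -/
def normalOrdered (b : ℕ+ → ℂ) {r : ℕ} (k : Fin r → ℤ) : Module.End Coupling Sources :=
  (((List.ofFn k).filter (fun i => i < 0)).map (alpha b)).prod *
    (((List.ofFn k).filter (fun i => 0 ≤ i)).map (alpha b)).prod

/-- With `∂φ₀(ζ) = (1/p) ∑ₖ αₖ ζ^(-k/p-1)`, one has
`φ₀(ζ(1+u)) - φ₀(ζ) = ∑ₖ αₖ ζ^(-k/p) eₖ(u)`; this is the power series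
`eₖ(u) = ∫₀ᵘ (1/p) (1+v)^(-k/p-1) dv`. -/
def bosonIncrement (p : ℕ) (k : ℤ) : PowerSeries ℂ :=
  PowerSeries.mk fun n =>
    if n = 0 then 0 else Ring.choose (-(k : ℂ) / p - 1) (n - 1) / (p * n)

/-- The factor relating the two normal orderings. With `λ = ζ^(1/p)` and `λ' = ζ'^(1/p)`,
`:exp(φ₀(ζ') - φ₀(ζ)): = (ζ' - ζ) c₀(ζ') c̄₀(ζ)`
`  = (ζ' - ζ) / (λ' - λ) * (dλ'/dζ' * dλ/dζ)^(1/2) * °exp(φ(λ') - φ(λ))°`,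
where `: :` is the normal ordering for the `ζ` plane and `° °` is the one of the oscillators.
For `ζ' = ζ(1+u)` the factor is `u / ((1+u)^(1/p) - 1) * (1/p) * (1+u)^((1/p-1)/2)`. -/
def orderingFactor (p : ℕ) : PowerSeries ℂ :=
  PowerSeries.C ((p : ℂ)⁻¹) *
    PowerSeries.binomialSeries ℂ (((p : ℂ)⁻¹ - 1) / 2) *
    (PowerSeries.mk fun n =>
      PowerSeries.coeff (n + 1) (PowerSeries.binomialSeries ℂ ((p : ℂ)⁻¹)))⁻¹

/-- The mode `Wˢₙ` of the current
`Wˢ(ζ) = ∑_{a=0}^{p-1} :exp(-φₐ(ζ)) ∂ˢ exp(φₐ(ζ)): = ∑ₙ Wˢₙ ζ^(-n-s)`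
(equivalently `s ∑ₐ :∂^(s-1)cₐ(ζ) c̄ₐ(ζ):`), where `φₐ(ζ) = φ₀(exp(2πia) ζ)`. The summand `a = 0`
is `s!` times the coefficient of `u^s` in `:exp(φ₀(ζ(1+u)) - φ₀(ζ)):`, times `ζ^(-s)`; expanding
the exponential gives monomials of degree `r ≤ s` in the oscillators. The sum over the `p` sheets
multiplies the integer powers of `ζ` by `p` and removes the others. For a background with finitely
many nonzero `bₙ`, only finitely many tuples `k` contribute to a given coefficient. -/
def wMode (p : ℕ) (b : ℕ+ → ℂ) (s : ℕ) (n : ℤ) (Z : Sources) : Sources := fun J =>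
  ∑ r ∈ Finset.range (s + 1),
    ∑ᶠ k ∈ {k : Fin r → ℤ | ∑ i, k i = p * n},
      HahnSeries.C ((p : ℂ) * s ! / r ! *
          PowerSeries.coeff s (orderingFactor p * ∏ i, bosonIncrement p (k i))) *
        MvPowerSeries.coeff J (normalOrdered b k Z)

/-- The `W_{1+∞}` constraints `Wˢₙ |Φ⟩ = 0` for `s ≥ 1` and `n ≥ -s+1`. -/
def WConstraints (p : ℕ) (b : ℕ+ → ℂ) (Z : Sources) : Prop :=
  ∀ s : ℕ, 1 ≤ s → ∀ n : ℤ, 1 - (s : ℤ) ≤ n → wMode p b s n Z = 0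

/-- The generating function `Z(j) = exp F(j)`, for `F` without constant term. -/
def partitionFunction (F : Sources) : Sources := (PowerSeries.exp Coupling).subst F

/-- `F(j) = ∑_{N≥1} (1/N!) ∑_{n₁,…,n_N} ∑_{h≥0} g^(2h+N-2) j_{n₁} ⋯ j_{n_N} ⟨O_{n₁} ⋯ O_{n_N}⟩_c^(h)`:
the coefficient of a monomial of degree `N` involves only the powers `g^(2h+N-2)`, `h ≥ 0`. -/
def HasGenusExpansion (F : Sources) : Prop :=
  MvPowerSeries.constantCoeff F = 0 ∧
    ∀ (J : ℕ+ →₀ ℕ) (i : ℤ), (MvPowerSeries.coeff J F).coeff i ≠ 0 →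
      ∃ h : ℕ, i = 2 * h + (J.degree : ℤ) - 2

/-- `⟨b/g| · · · |Φ⟩ / ⟨b/g|Φ⟩`, where the argument is the series representing `· · · |Φ⟩`. -/
def vev (Y : Sources) : Coupling := MvPowerSeries.constantCoeff Y

/-- The coefficient of `ζ₁^M ζ₂^N` in the expansion of `⟨⟨Wˢ(ζ₁) Wᵗ(ζ₂)⟩⟩_c` in the region (I)
`|ζ₁| > |ζ₂|`, where the radial ordering puts `Wˢ(ζ₁)` to the left of `Wᵗ(ζ₂)`. -/
def connectedI (p : ℕ) (b : ℕ+ → ℂ) (Z : Sources) (s t : ℕ) (M N : ℤ) : Coupling :=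
  vev (wMode p b s (-M - s) (wMode p b t (-N - t) Z)) -
    vev (wMode p b s (-M - s) Z) * vev (wMode p b t (-N - t) Z)

/-- The coefficient of `ζ₁^M ζ₂^N` in the expansion of `⟨⟨Wˢ(ζ₁) Wᵗ(ζ₂)⟩⟩_c` in the region (II)
`|ζ₂| > |ζ₁|`, where the radial ordering puts `Wᵗ(ζ₂)` to the left of `Wˢ(ζ₁)`. -/
def connectedII (p : ℕ) (b : ℕ+ → ℂ) (Z : Sources) (s t : ℕ) (M N : ℤ) : Coupling :=
  vev (wMode p b t (-N - t) (wMode p b s (-M - s) Z)) -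
    vev (wMode p b s (-M - s) Z) * vev (wMode p b t (-N - t) Z)

/-- Condition (W1) on the weak coupling limit of `⟨⟨Wˢ(ζ₁) Wᵗ(ζ₂)⟩⟩_c`, its term of order
`g^(2-s-t)`: the coefficients in the region (I) vanish unless `N ≥ 0` and `M + N ≥ -2`. -/
def ConditionW1 (p : ℕ) (b : ℕ+ → ℂ) (Z : Sources) (s t : ℕ) : Prop :=
  ∀ M N : ℤ, ¬ (0 ≤ N ∧ -2 ≤ M + N) →
    (connectedI p b Z s t M N).coeff (2 - (s : ℤ) - t) = 0

/-- Condition (W2) on the weak coupling limit of `⟨⟨Wˢ(ζ₁) Wᵗ(ζ₂)⟩⟩_c`, its term of order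
`g^(2-s-t)`: the coefficients in the region (II) vanish unless `M ≥ 0` and `M + N ≥ -2`. -/
def ConditionW2 (p : ℕ) (b : ℕ+ → ℂ) (Z : Sources) (s t : ℕ) : Prop :=
  ∀ M N : ℤ, ¬ (0 ≤ M ∧ -2 ≤ M + N) →
    (connectedII p b Z s t M N).coeff (2 - (s : ℤ) - t) = 0

/-- The `W_{1+∞}` constraints in the weak coupling limit for disk amplitudes:
the term of order `g^(-s)` of `⟨Wˢₙ⟩` vanishes for `s ≥ 1`, `n ≥ -s+1`. -/
def DiskConstraints (p : ℕ) (b : ℕ+ → ℂ) (Z : Sources) : Prop :=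
  ∀ s : ℕ, 1 ≤ s → ∀ n : ℤ, 1 - (s : ℤ) ≤ n →
    (vev (wMode p b s n Z)).coeff (-(s : ℤ)) = 0

/-- The `W_{1+∞}` constraints in the weak coupling limit for annulus amplitudes: the term of order
`g^(1-t)` of `⟨αₖ Wᵗₙ⟩ - ⟨αₖ⟩⟨Wᵗₙ⟩`, i.e. of the derivative of `⟨Wᵗₙ⟩` in the direction of an
arbitrary source `jₖ`, vanishes for `k ≥ 1`, `t ≥ 1`, `n ≥ -t+1`. -/
def AnnulusConstraints (p : ℕ) (b : ℕ+ → ℂ) (Z : Sources) : Prop :=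
  ∀ k : ℕ, 1 ≤ k → ∀ t : ℕ, 1 ≤ t → ∀ n : ℤ, 1 - (t : ℤ) ≤ n →
    (vev (alpha b k (wMode p b t n Z)) - vev (alpha b k Z) * vev (wMode p b t n Z)).coeff
      (1 - (t : ℤ)) = 0

end MinimalString

end

noncomputable section

namespace MinimalString

/-! Conjugation by `partitionFunction F` turns each oscillator `αₖ` into multiplication by `current
b F k` plus, for `k ≥ 1`, the derivative `∂/∂jₖ`. The genus expansion gives a current order `g⁻¹`,
and a derivative that acts in place of a current costs `g²`. Hence the leading term of `⟨Wˢₙ⟩` is a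
sum of products of disk amplitudes, and the leading term of the connected function of two modes has
exactly one contraction. At this order only the monomials of top degree survive, with a weight
independent of their indices.

Let `y` be the Laurent series of disk amplitudes and `A t m` that of the annulus amplitudes of `αₖ`
with the mode `m` of `W^(t+1)`. The disk constraints say that `y ^ s` has zero coefficient at `p *
n` for `n ≥ 1 - s`, and the annulus constraints that `A t m = 0` for `m ≥ -t`. The connected
function of modes `n` of `W^(s+1)` and `m` of `W^(t+1)` is, up to a nonzero constant, the
coefficient of `A t m * y ^ s` at `p * n`. (W2) is (W1) with the two currents exchanged, so
everything is a statement about these coefficients (`exists_weakCouplingLimit`).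

Two facts carry the equivalence. By `pairing_sub_pairing`, exchanging the operators changes the
coefficient by a commutator term, which for `s + t > 0` is `p (t n - s m) / (s + t)` times the
coefficient of `y ^ (s + t)` at `p * (n + m)`: this links the two regions to the disk constraints.
By `eq_zero_of_forall_coeff_mul_pow`, since `y` has order `-(p + q)`, prime to `p`, the series `A t
m` is detected by the coefficients of `A t m * y ^ j` at multiples of `p`: this yields the annulus
constraints. -/

/-! ### The exponential of the free energy -/

open MvPowerSeries in
theorem coeff_pow_eq_zero_of_degree_lt {F : Sources} (hF : constantCoeff F = 0) {J : ℕ+ →₀ ℕ}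
    {d : ℕ} (h : J.degree < d) : coeff J (F ^ d) = 0 := by
  apply coeff_of_lt_order
  have h1 : (1 : ℕ∞) ≤ F.order := by
    rw [one_le_order_iff_constCoeff_eq_zero]; exact hF
  calc (J.degree : ℕ∞) < d := by exact_mod_cast h
    _ = d • (1 : ℕ∞) := by simp
    _ ≤ d • F.order := by gcongr
    _ ≤ (F ^ d).order := le_order_pow d

-- Since `F` has no constant term, `F ^ d` starts in degree `d`. Each coefficient of the exponential
-- is thus one of a polynomial in `F`, to which ordinary algebra applies.
open MvPowerSeries in
theorem coeff_partitionFunction {F : Sources} (hF : constantCoeff F = 0) {J : ℕ+ →₀ ℕ}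
    {D : ℕ} (h : J.degree ≤ D) :
    coeff J (partitionFunction F) =
      coeff J (∑ d ∈ Finset.range (D + 1), ((d ! : ℕ) : Coupling)⁻¹ • F ^ d) := by
  rw [partitionFunction, PowerSeries.coeff_subst (PowerSeries.HasSubst.of_constantCoeff_zero hF),
    finsum_eq_sum_of_support_subset (s := Finset.range (D + 1)), map_sum]
  · refine Finset.sum_congr rfl fun d _ => ?_
    simp [PowerSeries.coeff_exp]
  · intro d hd
    by_contra hd'
    apply hd
    simp only [Finset.coe_range, Set.mem_Iio] at hd'
    simp only
    rw [coeff_pow_eq_zero_of_degree_lt hF (by omega)]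
    exact mul_zero (M₀ := Coupling) _

open MvPowerSeries in
theorem pderiv_partitionFunction {F : Sources} (hF : constantCoeff F = 0) (n : ℕ+) :
    pderiv Coupling n (partitionFunction F) = pderiv Coupling n F * partitionFunction F := by
  ext1 J
  have h1 : ∀ D : ℕ, pderiv Coupling n
      (∑ d ∈ Finset.range (D + 2), ((d ! : ℕ) : Coupling)⁻¹ • F ^ d) =
      pderiv Coupling n F * ∑ d ∈ Finset.range (D + 1), ((d ! : ℕ) : Coupling)⁻¹ • F ^ d := by
    intro D
    rw [Finset.sum_range_succ', map_add, map_sum, Finset.mul_sum]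
    simp only [pow_zero, Derivation.map_smul, Derivation.map_one_eq_zero, smul_zero, add_zero]
    refine Finset.sum_congr rfl fun d _ => ?_
    rw [Derivation.leibniz_pow, Nat.factorial_succ, Nat.add_sub_cancel, ← Nat.cast_smul_eq_nsmul Coupling,
      smul_smul, smul_eq_mul, mul_smul_comm, mul_comm (F ^ d)]
    congr 1
    have := algebraRat.charZero Coupling
    have : ((d + 1 : ℕ) : Coupling) ≠ 0 := Nat.cast_ne_zero.mpr (by omega)
    have : ((d ! : ℕ) : Coupling) ≠ 0 := Nat.cast_ne_zero.mpr (Nat.factorial_ne_zero d)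
    push_cast at *
    field_simp
  -- The derivative lowers the degree by one, so the truncation has to reach one degree beyond `J`.
  have h2 : coeff J (pderiv Coupling n (partitionFunction F)) =
      coeff J (pderiv Coupling n
        (∑ d ∈ Finset.range (J.degree + 2), ((d ! : ℕ) : Coupling)⁻¹ • F ^ d)) := by
    rw [coeff_pderiv, coeff_pderiv, coeff_partitionFunction hF (D := J.degree + 1)]
    simp
  rw [h2, h1, coeff_mul, coeff_mul]
  refine Finset.sum_congr rfl fun x hx => ?_
  rw [coeff_partitionFunction hF (D := J.degree)]
  rw [← Finset.HasAntidiagonal.mem_antidiagonal.mp hx]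
  simp

theorem vev_partitionFunction {F : Sources} (hF : MvPowerSeries.constantCoeff F = 0) :
    vev (partitionFunction F) = 1 := by
  rw [vev, ← MvPowerSeries.coeff_zero_eq_constantCoeff_apply,
    coeff_partitionFunction hF (D := 0) (by simp)]
  simp

/-! ### Filtrations by powers of the coupling -/

/-- The series in `g` without powers below `g^d`. -/
def couplingFiltration (d : ℤ) : AddSubgroup Coupling where
  carrier := {x | ∀ i < d, x.coeff i = 0}
  zero_mem' := by simp
  add_mem' := by
    intro x y hx hy i hi
    simp [hx i hi, hy i hi]
  neg_mem' := by
    intro x hx i hi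
    simp [hx i hi]

theorem couplingFiltration_anti {d e : ℤ} (h : e ≤ d) :
    couplingFiltration d ≤ couplingFiltration e := fun _ hx i hi => hx i (hi.trans_le h)

theorem mul_mem_couplingFiltration {x y : Coupling} {d e : ℤ} (hx : x ∈ couplingFiltration d)
    (hy : y ∈ couplingFiltration e) : x * y ∈ couplingFiltration (d + e) := by
  intro i hi
  rw [HahnSeries.coeff_mul]
  refine Finset.sum_eq_zero fun ij hij => ?_
  rw [Finset.mem_antidiagonal] at hij
  obtain h | h := lt_or_ge ij.1 d
  · exact absurd (hx _ h) hij.1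
  · exact absurd (hy ij.2 (by have := hij.2.2; omega)) hij.2.1

theorem coeff_mul_of_mem {x y : Coupling} {d e f : ℤ} (hx : x ∈ couplingFiltration d)
    (hy : y ∈ couplingFiltration e) (hf : f = d + e) :
    (x * y).coeff f = x.coeff d * y.coeff e := by
  subst hf
  have key : ∀ ij ∈ Finset.antidiagonal x.isPWO_support y.isPWO_support (d + e),
      ij = (d, e) := by
    intro ij hij
    rw [Finset.mem_antidiagonal] at hij
    have h1 : d ≤ ij.1 := by
      by_contra! h'
      exact hij.1 (hx _ h')
    have h2 : e ≤ ij.2 := by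
      by_contra! h'
      exact hij.2.1 (hy _ h')
    have := hij.2.2
    exact Prod.ext (by simp only; omega) (by simp only; omega)
  rw [HahnSeries.coeff_mul]
  refine Finset.sum_eq_single (d, e) (fun ij hij hne => absurd (key ij hij) hne) fun h => ?_
  by_contra h0
  exact h (Finset.mem_antidiagonal.mpr ⟨left_ne_zero_of_mul h0, right_ne_zero_of_mul h0, rfl⟩)

/-- The series in which a monomial of degree `N` has no power of `g` below `g^(N+d)`. -/
def sourceFiltration (d : ℤ) : AddSubgroup Sources where
  carrier := {P | ∀ J : ℕ+ →₀ ℕ,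
    MvPowerSeries.coeff J P ∈ couplingFiltration ((J.degree : ℤ) + d)}
  zero_mem' := fun J => by simp
  add_mem' := fun hx hy J => by simpa using add_mem (hx J) (hy J)
  neg_mem' := fun hx J => by simpa using neg_mem (hx J)

theorem sourceFiltration_anti {d e : ℤ} (h : e ≤ d) :
    sourceFiltration d ≤ sourceFiltration e :=
  fun _ hx J => couplingFiltration_anti (by omega) (hx J)

theorem mul_mem_sourceFiltration {P Q : Sources} {d e : ℤ} (hP : P ∈ sourceFiltration d)
    (hQ : Q ∈ sourceFiltration e) : P * Q ∈ sourceFiltration (d + e) := by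
  intro J
  rw [MvPowerSeries.coeff_mul]
  refine sum_mem fun x hx => ?_
  refine couplingFiltration_anti (le_of_eq ?_) (mul_mem_couplingFiltration (hP x.1) (hQ x.2))
  rw [← Finset.HasAntidiagonal.mem_antidiagonal.mp hx]
  simp; ring

theorem one_mem_sourceFiltration : (1 : Sources) ∈ sourceFiltration 0 := by
  intro J i hi
  rw [MvPowerSeries.coeff_one]
  split_ifs with h
  · subst h
    simp at hi
    rw [HahnSeries.coeff_one, if_neg (by omega)]
  · simp

/-- The coefficient at `J` comes from a monomial of degree one higher, whose bound is one power of
`g` better. -/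
theorem pderiv_mem_sourceFiltration {P : Sources} {d : ℤ} (hP : P ∈ sourceFiltration d) (n : ℕ+) :
    MvPowerSeries.pderiv Coupling n P ∈ sourceFiltration (d + 1) := by
  intro J i hi
  rw [MvPowerSeries.coeff_pderiv]
  have := hP (J + Finsupp.single n 1)
  have h2 : ((J n : Coupling) + 1) = HahnSeries.C ((J n : ℂ) + 1) := by
    rw [map_add, map_natCast, map_one]
  rw [h2, mul_comm, HahnSeries.C_mul_eq_smul, HahnSeries.coeff_smul,
    this i (by simp; omega), smul_zero]

theorem vev_mem {P : Sources} {d : ℤ} (hP : P ∈ sourceFiltration d) :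
    vev P ∈ couplingFiltration d := by
  have := hP 0
  simpa [vev] using this

theorem vev_mul (P Q : Sources) : vev (P * Q) = vev P * vev Q := map_mul _ _ _

theorem vev_coeff_mul {P Q : Sources} {d e f : ℤ} (hP : P ∈ sourceFiltration d)
    (hQ : Q ∈ sourceFiltration e) (hf : f = d + e) :
    (vev (P * Q)).coeff f = (vev P).coeff d * (vev Q).coeff e := by
  rw [vev_mul, coeff_mul_of_mem (vev_mem hP) (vev_mem hQ) hf]

theorem vev_coeff_congr {P Q : Sources} {d f : ℤ} (h : P - Q ∈ sourceFiltration d) (hf : f < d) :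
    (vev P).coeff f = (vev Q).coeff f := by
  have := vev_mem h f hf
  rw [vev, map_sub, HahnSeries.coeff_sub, sub_eq_zero] at this
  exact this

/-! ### Conjugation of oscillators and modes by the partition function -/

/-- The function `exp(-F) αₖ exp(F)`, the multiplicative part of the oscillator `αₖ` conjugated
by the partition function. -/
def current (b : ℕ+ → ℂ) (F : Sources) : ℤ → Sources
  | Int.ofNat 0 => 0
  | Int.ofNat (n + 1) => MvPowerSeries.pderiv Coupling n.succPNat F
  | Int.negSucc n => (n.succPNat : ℕ) •
      (MvPowerSeries.C (HahnSeries.single (-1 : ℤ) (b n.succPNat)) +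
        MvPowerSeries.X n.succPNat)

/-- The derivative part `∂/∂jₖ` of the oscillator `αₖ`, zero for `k ≤ 0`. -/
def sourceDeriv : ℤ → Derivation Coupling Sources Sources
  | Int.ofNat 0 => 0
  | Int.ofNat (n + 1) => MvPowerSeries.pderiv Coupling n.succPNat
  | Int.negSucc _ => 0

/-- The oscillator `αₖ` conjugated by the partition function. -/
def dressed (b : ℕ+ → ℂ) (F : Sources) (k : ℤ) : Module.End Coupling Sources :=
  Algebra.lmul Coupling Sources (current b F k) + (sourceDeriv k).toLinearMap

theorem dressed_apply (b : ℕ+ → ℂ) (F : Sources) (k : ℤ) (P : Sources) :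
    dressed b F k P = current b F k * P + sourceDeriv k P := rfl

theorem sourceDeriv_of_nonpos {k : ℤ} (hk : k ≤ 0) : sourceDeriv k = 0 := by
  match k with
  | Int.ofNat 0 => rfl
  | Int.ofNat (n + 1) => exact absurd hk (by simp only [Int.ofNat_eq_natCast]; omega)
  | Int.negSucc _ => rfl

theorem alpha_mul_partitionFunction (b : ℕ+ → ℂ) {F : Sources}
    (hF : MvPowerSeries.constantCoeff F = 0) (k : ℤ) (P : Sources) :
    alpha b k (P * partitionFunction F) = dressed b F k P * partitionFunction F := by
  rw [dressed_apply]
  match k with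
  | Int.ofNat 0 => simp [alpha, current, sourceDeriv]
  | Int.ofNat (n + 1) =>
    simp only [alpha, current, sourceDeriv, Derivation.coeFn_coe, Derivation.leibniz,
      pderiv_partitionFunction hF, smul_eq_mul]
    ring
  | Int.negSucc n =>
    simp only [alpha, current, sourceDeriv, Algebra.coe_lmul_eq_mul,
      LinearMap.mul_apply', Derivation.coe_zero, Pi.zero_apply, add_zero]
    ring

theorem prod_alpha_mul_partitionFunction (b : ℕ+ → ℂ) {F : Sources}
    (hF : MvPowerSeries.constantCoeff F = 0) (l : List ℤ) (P : Sources) :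
    (l.map (alpha b)).prod (P * partitionFunction F) =
      (l.map (dressed b F)).prod P * partitionFunction F := by
  induction l with
  | nil => simp
  | cons k l ih =>
    simp only [List.map_cons, List.prod_cons, Module.End.mul_apply, ih,
      alpha_mul_partitionFunction b hF]

/-- The indices of a monomial, reordered so that creation operators stand to the left. -/
def creationFirst {r : ℕ} (k : Fin r → ℤ) : List ℤ :=
  (List.ofFn k).filter (fun i => i < 0) ++ (List.ofFn k).filter (fun i => 0 ≤ i)

theorem creationFirst_perm {r : ℕ} (k : Fin r → ℤ) : (creationFirst k).Perm (List.ofFn k) := by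
  have := List.filter_append_perm (fun i : ℤ => decide (i < 0)) (List.ofFn k)
  simpa only [creationFirst, ← decide_not, not_lt] using this

/-- The normal ordered monomial conjugated by the partition function. -/
def dressedOrdered (b : ℕ+ → ℂ) (F : Sources) {r : ℕ} (k : Fin r → ℤ) :
    Module.End Coupling Sources :=
  ((creationFirst k).map (dressed b F)).prod

theorem normalOrdered_mul_partitionFunction (b : ℕ+ → ℂ) {F : Sources}
    (hF : MvPowerSeries.constantCoeff F = 0) {r : ℕ} (k : Fin r → ℤ) (P : Sources) :
    normalOrdered b k (P * partitionFunction F) =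
      dressedOrdered b F k P * partitionFunction F := by
  rw [normalOrdered, dressedOrdered, ← prod_alpha_mul_partitionFunction b hF, creationFirst,
    List.map_append, List.prod_append]

theorem prod_dressed_of_forall_neg (b : ℕ+ → ℂ) (F : Sources) (l : List ℤ)
    (hl : ∀ k ∈ l, k < 0) (P : Sources) :
    (l.map (dressed b F)).prod P = (l.map (current b F)).prod * P := by
  induction l with
  | nil => simp
  | cons k l ih =>
    simp only [List.map_cons, List.prod_cons, Module.End.mul_apply]
    rw [ih fun k' hk' => hl k' (List.mem_cons_of_mem _ hk'), dressed_apply,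
      sourceDeriv_of_nonpos (hl k List.mem_cons_self).le]
    simp [mul_assoc]

/-- Creation operators stand on the left and contain no derivative. If the background vanishes at
`m`, one of them is a multiple of `jₘ`, and this factor survives in the result. -/
theorem coeff_dressedOrdered_eq_zero {b : ℕ+ → ℂ} (F : Sources) {r : ℕ} (k : Fin r → ℤ)
    (P : Sources) {J : ℕ+ →₀ ℕ} {i : Fin r} {m : ℕ+} (hk : k i = -(m : ℤ)) (hm : b m = 0)
    (hJ : J m = 0) :
    MvPowerSeries.coeff J (dressedOrdered b F k P) = 0 := by
  rw [dressedOrdered, creationFirst, List.map_append, List.prod_append, Module.End.mul_apply,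
    prod_dressed_of_forall_neg _ _ _ (by simp)]
  have hmem : k i ∈ (List.ofFn k).filter (fun i => i < 0) := by
    simp only [List.mem_filter, List.mem_ofFn, exists_apply_eq_apply, true_and]
    simp [hk]
  have hX : MvPowerSeries.X m ∣ current b F (k i) := by
    rw [hk]
    obtain ⟨n, rfl⟩ : ∃ n : ℕ, m = n.succPNat := ⟨m.natPred, by simp⟩
    have : (-((n.succPNat : ℕ+) : ℤ)) = Int.negSucc n := by
      simp [Int.negSucc_eq]
    rw [this, current, hm]
    simp
  have hdvd : MvPowerSeries.X m ∣
      (((List.ofFn k).filter (fun i => i < 0)).map (current b F)).prod *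
        (((List.ofFn k).filter (fun i => 0 ≤ i)).map (dressed b F)).prod P :=
    (hX.trans (List.dvd_prod (List.mem_map_of_mem hmem))).mul_right _
  exact (MvPowerSeries.X_dvd_iff.mp hdvd) J hJ

/-- Entries below `-C` give zero once `C` exceeds the background and the support of `J`; the fixed
sum then bounds all entries from above. -/
theorem finite_coeff_dressedOrdered {b : ℕ+ → ℂ} {B : ℕ}
    (hb : ∀ n : ℕ+, B < (n : ℕ) → b n = 0) (F : Sources) (r : ℕ) (N : ℤ) (P : Sources)
    (J : ℕ+ →₀ ℕ) :
    {k : Fin r → ℤ | ∑ i, k i = N ∧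
      MvPowerSeries.coeff J (dressedOrdered b F k P) ≠ 0}.Finite := by
  obtain ⟨C, hC⟩ : ∃ C : ℕ, ∀ m : ℕ+, C < (m : ℕ) → b m = 0 ∧ J m = 0 := by
    refine ⟨max B (J.support.sup fun m => (m : ℕ)), fun m hm => ?_⟩
    rw [max_lt_iff] at hm
    refine ⟨hb m hm.1, ?_⟩
    by_contra h
    exact absurd (Finset.le_sup (f := fun m : ℕ+ => (m : ℕ)) (Finsupp.mem_support_iff.mpr h))
      (by simpa using hm.2)
  refine (Set.Finite.pi (t := fun _ : Fin r => Set.Icc (-(C : ℤ)) (N + r * C))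
    fun _ => Set.finite_Icc _ _).subset ?_
  rintro k ⟨hN, hk⟩
  have hlow : ∀ i, -(C : ℤ) ≤ k i := by
    intro i
    by_contra! h
    have hpos : 0 < (-k i).toNat := by omega
    refine hk (coeff_dressedOrdered_eq_zero F k P (i := i) (m := ⟨(-k i).toNat, hpos⟩) ?_ ?_ ?_)
    · simp only [PNat.mk_coe]; omega
    · exact (hC _ (by simp only [PNat.mk_coe]; omega)).1
    · exact (hC _ (by simp only [PNat.mk_coe]; omega)).2
  intro i _
  refine ⟨hlow i, ?_⟩
  have h1 : ∑ j, (k j + C) = N + r * C := by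
    rw [Finset.sum_add_distrib, hN]; simp
  have h2 : k i + C ≤ ∑ j, (k j + C) :=
    Finset.single_le_sum (f := fun j => k j + (C : ℤ)) (fun j _ => by have := hlow j; omega)
      (Finset.mem_univ i)
  omega

/-- The numerical factor of a normal ordered monomial in a mode of `Wˢ`. -/
def modeWeight (p s : ℕ) {r : ℕ} (k : Fin r → ℤ) : ℂ :=
  (p : ℂ) * s ! / r ! * PowerSeries.coeff s (orderingFactor p * ∏ i, bosonIncrement p (k i))

/-- The mode `Wˢₙ` conjugated by the partition function. -/
def dressedMode (p : ℕ) (b : ℕ+ → ℂ) (F : Sources) (s : ℕ) (n : ℤ) (P : Sources) : Sources :=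
  fun J => ∑ r ∈ Finset.range (s + 1), ∑ᶠ k ∈ {k : Fin r → ℤ | ∑ i, k i = p * n},
    HahnSeries.C (modeWeight p s k) * MvPowerSeries.coeff J (dressedOrdered b F k P)

theorem coeff_dressedMode (p : ℕ) (b : ℕ+ → ℂ) (F : Sources) (s : ℕ) (n : ℤ) (P : Sources)
    (J : ℕ+ →₀ ℕ) : MvPowerSeries.coeff J (dressedMode p b F s n P) =
      ∑ r ∈ Finset.range (s + 1), ∑ᶠ k ∈ {k : Fin r → ℤ | ∑ i, k i = p * n},
        HahnSeries.C (modeWeight p s k) * MvPowerSeries.coeff J (dressedOrdered b F k P) := rfl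

theorem finite_support_dressedMode {b : ℕ+ → ℂ} {B : ℕ}
    (hb : ∀ n : ℕ+, B < (n : ℕ) → b n = 0) (F : Sources) (r : ℕ) (N : ℤ) (P : Sources)
    (J : ℕ+ →₀ ℕ) (w : (Fin r → ℤ) → Coupling) :
    ({k : Fin r → ℤ | ∑ i, k i = N} ∩ Function.support fun k =>
      w k * MvPowerSeries.coeff J (dressedOrdered b F k P)).Finite :=
  (finite_coeff_dressedOrdered hb F r N P J).subset fun _ hk =>
    ⟨hk.1, right_ne_zero_of_mul hk.2⟩

theorem wMode_mul_partitionFunction (p : ℕ) {b : ℕ+ → ℂ} {B : ℕ}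
    (hb : ∀ n : ℕ+, B < (n : ℕ) → b n = 0) {F : Sources}
    (hF : MvPowerSeries.constantCoeff F = 0) (s : ℕ) (n : ℤ) (P : Sources) :
    wMode p b s n (P * partitionFunction F) =
      dressedMode p b F s n P * partitionFunction F := by
  ext1 J
  rw [MvPowerSeries.coeff_mul]
  simp only [coeff_dressedMode]
  change ∑ r ∈ Finset.range (s + 1), ∑ᶠ k ∈ {k : Fin r → ℤ | ∑ i, k i = p * n},
    HahnSeries.C (modeWeight p s k) *
      MvPowerSeries.coeff J (normalOrdered b k (P * partitionFunction F)) = _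
  simp_rw [Finset.sum_mul]
  rw [Finset.sum_comm]
  refine Finset.sum_congr rfl fun r _ => ?_
  -- One finite set of tuples serves all splittings of `J`, so that the sum over tuples commutes
  -- with the product of series.
  have hfin : (⋃ x ∈ Finset.HasAntidiagonal.antidiagonal J, {k : Fin r → ℤ | ∑ i, k i = p * n ∧
      MvPowerSeries.coeff x.1 (dressedOrdered b F k P) ≠ 0}).Finite :=
    (Finset.HasAntidiagonal.antidiagonal J).finite_toSet.biUnion fun x _ =>
      finite_coeff_dressedOrdered hb F r (p * n) P x.1
  have hsub : (hfin.toFinset : Set (Fin r → ℤ)) ⊆ {k : Fin r → ℤ | ∑ i, k i = p * n} := by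
    intro k hk
    simp only [Set.Finite.coe_toFinset, Set.mem_iUnion] at hk
    obtain ⟨x, _, hk⟩ := hk
    exact hk.1
  have hright : ∀ x ∈ Finset.HasAntidiagonal.antidiagonal J,
      ∑ᶠ k ∈ {k : Fin r → ℤ | ∑ i, k i = p * n}, HahnSeries.C (modeWeight p s k) *
          MvPowerSeries.coeff x.1 (dressedOrdered b F k P) =
        ∑ k ∈ hfin.toFinset, HahnSeries.C (modeWeight p s k) *
          MvPowerSeries.coeff x.1 (dressedOrdered b F k P) := by
    intro x hx
    refine finsum_mem_eq_sum_of_subset _ (fun k hk => ?_) hsub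
    simp only [Set.Finite.coe_toFinset, Set.mem_iUnion]
    exact ⟨x, hx, hk.1, right_ne_zero_of_mul hk.2⟩
  have hcoeff : ∀ k : Fin r → ℤ, HahnSeries.C (modeWeight p s k) *
      MvPowerSeries.coeff J (normalOrdered b k (P * partitionFunction F)) =
      ∑ x ∈ Finset.HasAntidiagonal.antidiagonal J, HahnSeries.C (modeWeight p s k) *
        MvPowerSeries.coeff x.1 (dressedOrdered b F k P) *
          MvPowerSeries.coeff x.2 (partitionFunction F) := by
    intro k
    rw [normalOrdered_mul_partitionFunction b hF, MvPowerSeries.coeff_mul, Finset.mul_sum]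
    simp only [mul_assoc]
  rw [finsum_mem_eq_sum_of_subset _ _ hsub]
  · rw [Finset.sum_congr rfl fun k _ => hcoeff k, Finset.sum_comm]
    exact Finset.sum_congr rfl fun x hx => by rw [hright x hx, Finset.sum_mul]
  · intro k hk
    have h := hk.2
    rw [Function.mem_support, hcoeff] at h
    obtain ⟨x, hx, hne⟩ := Finset.exists_ne_zero_of_sum_ne_zero h
    simp only [Set.Finite.coe_toFinset, Set.mem_iUnion]
    exact ⟨x, hx, hk.1, right_ne_zero_of_mul (left_ne_zero_of_mul hne)⟩

theorem vev_mul_partitionFunction {F : Sources} (hF : MvPowerSeries.constantCoeff F = 0)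
    (P : Sources) : vev (P * partitionFunction F) = vev P := by
  rw [vev_mul, vev_partitionFunction hF, mul_one]

/-- The series `exp(-F) Wˢₙ exp(F)`. -/
def modeSeries (p : ℕ) (b : ℕ+ → ℂ) (F : Sources) (s : ℕ) (n : ℤ) : Sources :=
  dressedMode p b F s n 1

theorem wMode_partitionFunction (p : ℕ) {b : ℕ+ → ℂ} {B : ℕ}
    (hb : ∀ n : ℕ+, B < (n : ℕ) → b n = 0) {F : Sources}
    (hF : MvPowerSeries.constantCoeff F = 0) (s : ℕ) (n : ℤ) :
    wMode p b s n (partitionFunction F) = modeSeries p b F s n * partitionFunction F := by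
  have := wMode_mul_partitionFunction p hb hF s n 1
  rwa [one_mul] at this

theorem connectedI_eq (p : ℕ) {b : ℕ+ → ℂ} {B : ℕ}
    (hb : ∀ n : ℕ+, B < (n : ℕ) → b n = 0) {F : Sources}
    (hF : MvPowerSeries.constantCoeff F = 0) (s t : ℕ) (M N : ℤ) :
    connectedI p b (partitionFunction F) s t M N =
      vev (dressedMode p b F s (-M - s) (modeSeries p b F t (-N - t)) -
        modeSeries p b F s (-M - s) * modeSeries p b F t (-N - t)) := by
  rw [connectedI, wMode_partitionFunction p hb hF, wMode_partitionFunction p hb hF,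
    wMode_mul_partitionFunction p hb hF, vev_mul_partitionFunction hF,
    vev_mul_partitionFunction hF, vev_mul_partitionFunction hF, ← vev_mul]
  exact (map_sub _ _ _).symm

theorem connectedII_eq_connectedI (p : ℕ) (b : ℕ+ → ℂ) (Z : Sources) (s t : ℕ) (M N : ℤ) :
    connectedII p b Z s t M N = connectedI p b Z t s N M := by
  rw [connectedI, connectedII, mul_comm (vev _) (vev _)]

theorem alpha_connected_eq (p : ℕ) {b : ℕ+ → ℂ} {B : ℕ}
    (hb : ∀ n : ℕ+, B < (n : ℕ) → b n = 0) {F : Sources}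
    (hF : MvPowerSeries.constantCoeff F = 0) (k : ℤ) (t : ℕ) (n : ℤ) :
    vev (alpha b k (wMode p b t n (partitionFunction F))) -
        vev (alpha b k (partitionFunction F)) * vev (wMode p b t n (partitionFunction F)) =
      vev (sourceDeriv k (modeSeries p b F t n)) := by
  have h : alpha b k (partitionFunction F) = current b F k * partitionFunction F := by
    have := alpha_mul_partitionFunction b hF k 1
    simpa [dressed_apply] using this
  rw [h, wMode_partitionFunction p hb hF, alpha_mul_partitionFunction b hF,
    vev_mul_partitionFunction hF, vev_mul_partitionFunction hF, vev_mul_partitionFunction hF,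
    dressed_apply, ← vev_mul]
  simp [vev]

/-! ### Counting powers of `g` in products of oscillators -/

theorem HasGenusExpansion.mem_sourceFiltration {F : Sources} (hF : HasGenusExpansion F) :
    F ∈ sourceFiltration (-2) := by
  intro J i hi
  by_contra h
  obtain ⟨m, hm⟩ := hF.2 J i h
  omega

/-- Background, source and `∂F` all meet the same bound: `bₙ / g` has degree 0 and order `-1`, `jₙ`
has degree 1 and order 0, and differentiation raises `-2` to `-1`. -/
theorem current_mem (b : ℕ+ → ℂ) {F : Sources} (hF : F ∈ sourceFiltration (-2)) (k : ℤ) :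
    current b F k ∈ sourceFiltration (-1) := by
  match k with
  | Int.ofNat 0 => exact zero_mem _
  | Int.ofNat (n + 1) => exact pderiv_mem_sourceFiltration hF _
  | Int.negSucc n =>
    refine nsmul_mem (add_mem ?_ ?_) _
    · intro J i hi
      rw [MvPowerSeries.coeff_C]
      split_ifs with h
      · subst h
        simp only [map_zero, Nat.cast_zero, zero_add] at hi
        exact HahnSeries.coeff_single_of_ne hi.ne
      · rfl
    · intro J i hi
      rw [MvPowerSeries.coeff_X]
      split_ifs with h
      · subst h
        rw [Finsupp.degree_single] at hi
        simp only [Nat.cast_one] at hi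
        rw [HahnSeries.coeff_one, if_neg (by omega)]
      · rfl

theorem sourceDeriv_mem {P : Sources} {d : ℤ} (hP : P ∈ sourceFiltration d) (k : ℤ) :
    sourceDeriv k P ∈ sourceFiltration (d + 1) := by
  match k with
  | Int.ofNat 0 => exact zero_mem _
  | Int.ofNat (n + 1) => exact pderiv_mem_sourceFiltration hP _
  | Int.negSucc n => exact zero_mem _

theorem prod_current_mem (b : ℕ+ → ℂ) {F : Sources} (hF : F ∈ sourceFiltration (-2))
    (l : List ℤ) : (l.map (current b F)).prod ∈ sourceFiltration (-(l.length : ℤ)) := by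
  induction l with
  | nil => simpa using one_mem_sourceFiltration
  | cons k l ih =>
    rw [List.map_cons, List.prod_cons]
    refine sourceFiltration_anti ?_ (mul_mem_sourceFiltration (current_mem b hF k) ih)
    simp

theorem prod_dressed_mem (b : ℕ+ → ℂ) {F : Sources} (hF : F ∈ sourceFiltration (-2))
    (l : List ℤ) {P : Sources} {d : ℤ} (hP : P ∈ sourceFiltration d) :
    (l.map (dressed b F)).prod P ∈ sourceFiltration (d - l.length) := by
  induction l with
  | nil => simpa using hP
  | cons k l ih =>
    rw [List.map_cons, List.prod_cons, Module.End.mul_apply, dressed_apply]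
    refine add_mem (sourceFiltration_anti ?_ (mul_mem_sourceFiltration (current_mem b hF k) ih))
      (sourceFiltration_anti ?_ (sourceDeriv_mem ih k))
    · simp; omega
    · simp; omega

/-- A current lowers the order by one and a derivative raises it by one, so every term containing a
derivative is suppressed by `g²`. -/
theorem prod_dressed_sub_mem (b : ℕ+ → ℂ) {F : Sources} (hF : F ∈ sourceFiltration (-2))
    (l : List ℤ) {P : Sources} {d : ℤ} (hP : P ∈ sourceFiltration d) :
    (l.map (dressed b F)).prod P - (l.map (current b F)).prod * P ∈
      sourceFiltration (d - l.length + 2) := by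
  induction l with
  | nil => simp
  | cons k l ih =>
    have h : ((k :: l).map (dressed b F)).prod P - ((k :: l).map (current b F)).prod * P =
        current b F k * ((l.map (dressed b F)).prod P - (l.map (current b F)).prod * P) +
          sourceDeriv k ((l.map (dressed b F)).prod P) := by
      simp only [List.map_cons, List.prod_cons, Module.End.mul_apply, dressed_apply]
      ring
    rw [h]
    refine add_mem (sourceFiltration_anti ?_ (mul_mem_sourceFiltration (current_mem b hF k) ih))
      (sourceFiltration_anti ?_ (sourceDeriv_mem (prod_dressed_mem b hF l hP) k))
    · simp; omega
    · simp; omega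

/-! ### The single contraction as leading connected term -/

/-- The part of a product of oscillators in which exactly one of them differentiates `P`, and the
others act by multiplication. -/
def singleContraction (b : ℕ+ → ℂ) (F P : Sources) (l : List ℤ) : Sources :=
  (Polynomial.derivative (l.map fun k => Polynomial.C (current b F k) +
    Polynomial.X * Polynomial.C (sourceDeriv k P)).prod).eval 0

theorem singleContraction_cons (b : ℕ+ → ℂ) (F P : Sources) (k : ℤ) (l : List ℤ) :
    singleContraction b F P (k :: l) = current b F k * singleContraction b F P l +
      sourceDeriv k P * (l.map (current b F)).prod := by
  have h : ((l.map fun k => Polynomial.C (current b F k) +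
      Polynomial.X * Polynomial.C (sourceDeriv k P)).prod).eval 0 =
      (l.map (current b F)).prod := by
    rw [← Polynomial.coe_evalRingHom, map_list_prod, List.map_map]
    congr 2
    funext k
    simp
  rw [singleContraction, List.map_cons, List.prod_cons, Polynomial.derivative_mul,
    Polynomial.eval_add, Polynomial.eval_mul, Polynomial.eval_mul, h, ← singleContraction]
  simp
  ring

theorem singleContraction_mem (b : ℕ+ → ℂ) {F : Sources} (hF : F ∈ sourceFiltration (-2))
    (l : List ℤ) {P : Sources} {d : ℤ} (hP : P ∈ sourceFiltration d) :
    singleContraction b F P l ∈ sourceFiltration (d - l.length + 2) := by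
  induction l with
  | nil => simp [singleContraction]
  | cons k l ih =>
    rw [singleContraction_cons]
    refine add_mem (sourceFiltration_anti ?_ (mul_mem_sourceFiltration (current_mem b hF k) ih))
      (sourceFiltration_anti ?_
        (mul_mem_sourceFiltration (sourceDeriv_mem hP k) (prod_current_mem b hF l)))
    · simp; omega
    · simp; omega

/-- Subtracting the disconnected product removes the terms in which no derivative reaches `P`. One
derivative on `P` with no other contraction is of relative order `g²`; anything further costs
another `g²`. In the induction the Leibniz rule cancels the term where the new derivative hits only
the product applied to `1`. -/
theorem prod_dressed_connected_mem (b : ℕ+ → ℂ) {F : Sources} (hF : F ∈ sourceFiltration (-2))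
    (l : List ℤ) {P : Sources} {d : ℤ} (hP : P ∈ sourceFiltration d) :
    (l.map (dressed b F)).prod P - (l.map (dressed b F)).prod 1 * P -
      singleContraction b F P l ∈ sourceFiltration (d - l.length + 4) := by
  induction l with
  | nil => simp [singleContraction]
  | cons k l ih =>
    have h : ((k :: l).map (dressed b F)).prod P - ((k :: l).map (dressed b F)).prod 1 * P -
        singleContraction b F P (k :: l) =
        current b F k * ((l.map (dressed b F)).prod P - (l.map (dressed b F)).prod 1 * P -
          singleContraction b F P l) +
        ((l.map (dressed b F)).prod 1 - (l.map (current b F)).prod * 1) * sourceDeriv k P +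
        sourceDeriv k (singleContraction b F P l) +
        sourceDeriv k ((l.map (dressed b F)).prod P - (l.map (dressed b F)).prod 1 * P -
          singleContraction b F P l) := by
      simp only [List.map_cons, List.prod_cons, Module.End.mul_apply, dressed_apply,
        singleContraction_cons, map_sub, Derivation.leibniz, smul_eq_mul]
      ring
    rw [h]
    refine add_mem (add_mem (add_mem
      (sourceFiltration_anti ?_ (mul_mem_sourceFiltration (current_mem b hF k) ih))
      (sourceFiltration_anti ?_ (mul_mem_sourceFiltration
        (prod_dressed_sub_mem b hF l one_mem_sourceFiltration) (sourceDeriv_mem hP k))))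
      (sourceFiltration_anti ?_ (sourceDeriv_mem (singleContraction_mem b hF l hP) k)))
      (sourceFiltration_anti ?_ (sourceDeriv_mem ih k))
    all_goals simp; omega

theorem length_creationFirst {r : ℕ} (k : Fin r → ℤ) : (creationFirst k).length = r := by
  rw [(creationFirst_perm k).length_eq, List.length_ofFn]

theorem prod_current_creationFirst (b : ℕ+ → ℂ) (F : Sources) {r : ℕ} (k : Fin r → ℤ) :
    ((creationFirst k).map (current b F)).prod = ∏ i, current b F (k i) := by
  rw [((creationFirst_perm k).map _).prod_eq, List.map_ofFn, List.prod_ofFn]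
  rfl

/-- Being the first derivative at 0 of a product of commuting polynomials, the contraction does not
depend on the order of the oscillators, so normal ordering is invisible at this order. -/
theorem singleContraction_creationFirst (b : ℕ+ → ℂ) (F P : Sources) {r : ℕ} (k : Fin r → ℤ) :
    singleContraction b F P (creationFirst k) =
      ∑ i, (∏ j ∈ Finset.univ.erase i, current b F (k j)) * sourceDeriv (k i) P := by
  have h := ((creationFirst_perm k).map fun k => Polynomial.C (current b F k) +
    Polynomial.X * Polynomial.C (sourceDeriv k P)).prod_eq
  rw [singleContraction, h, List.map_ofFn, List.prod_ofFn,
    Polynomial.derivative_prod_finset, Polynomial.eval_finsetSum]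
  refine Finset.sum_congr rfl fun i _ => ?_
  simp [Polynomial.eval_prod, Polynomial.derivative_mul]

theorem derivation_prod {ι A : Type*} [CommRing A] [Algebra Coupling A] [DecidableEq ι]
    (D : Derivation Coupling A A) (S : Finset ι) (f : ι → A) :
    D (∏ i ∈ S, f i) = ∑ i ∈ S, (∏ j ∈ S.erase i, f j) * D (f i) := by
  induction S using Finset.induction_on with
  | empty => simp
  | insert a S ha ih =>
    rw [Finset.prod_insert ha, Derivation.leibniz, ih, Finset.sum_insert ha,
      Finset.erase_insert ha, smul_eq_mul, smul_eq_mul, Finset.mul_sum, add_comm]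
    congr 1
    refine Finset.sum_congr rfl fun i hi => ?_
    rw [Finset.erase_insert_of_ne (by rintro rfl; exact ha hi),
      Finset.prod_insert (by simp [ha]), mul_assoc]

/-! ### Leading terms of normal ordered monomials -/

/-- The disk amplitude of `αₖ`: the term of order `g⁻¹` of `⟨αₖ⟩`. -/
def diskAmplitude (b : ℕ+ → ℂ) (F : Sources) (k : ℤ) : ℂ := (vev (current b F k)).coeff (-1)

/-- The term of order `g⁰` of the connected two point function of `αₖ` and `αₗ`, for `k ≥ 1`. -/
def annulusAmplitude (b : ℕ+ → ℂ) (F : Sources) (k l : ℤ) : ℂ :=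
  (vev (sourceDeriv k (current b F l))).coeff 0

theorem prod_current_finset_mem (b : ℕ+ → ℂ) {F : Sources} (hF : F ∈ sourceFiltration (-2))
    {ι : Type*} (S : Finset ι) (k : ι → ℤ) :
    ∏ i ∈ S, current b F (k i) ∈ sourceFiltration (-(S.card : ℤ)) ∧
      (vev (∏ i ∈ S, current b F (k i))).coeff (-(S.card : ℤ)) =
        ∏ i ∈ S, diskAmplitude b F (k i) := by
  classical
  induction S using Finset.induction_on with
  | empty =>
    refine ⟨by simpa using one_mem_sourceFiltration, ?_⟩
    simp [vev]
  | insert a S ha ih =>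
    rw [Finset.prod_insert ha, Finset.prod_insert ha, Finset.card_insert_of_notMem ha]
    refine ⟨sourceFiltration_anti ?_ (mul_mem_sourceFiltration (current_mem b hF _) ih.1), ?_⟩
    · push_cast; omega
    · rw [vev_coeff_mul (current_mem b hF _) ih.1 (by push_cast; omega), ih.2, diskAmplitude]

theorem vev_sum_contraction (b : ℕ+ → ℂ) {F : Sources} (hF : F ∈ sourceFiltration (-2))
    {r : ℕ} (k : Fin r → ℤ) {Q : Fin r → Sources} {e : ℤ} (hQ : ∀ i, Q i ∈ sourceFiltration e) :
    (vev (∑ i, (∏ j ∈ Finset.univ.erase i, current b F (k j)) * Q i)).coeff (e + 1 - r) =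
      ∑ i, (∏ j ∈ Finset.univ.erase i, diskAmplitude b F (k j)) * (vev (Q i)).coeff e := by
  rw [vev, map_sum, HahnSeries.coeff_sum]
  refine Finset.sum_congr rfl fun i _ => ?_
  have h := prod_current_finset_mem b hF (Finset.univ.erase i) k
  have hr : 0 < r := i.pos
  rw [← h.2]
  refine vev_coeff_mul h.1 (hQ i) ?_
  rw [Finset.card_erase_of_mem (Finset.mem_univ _), Finset.card_univ, Fintype.card_fin]
  omega

theorem dressedOrdered_mem (b : ℕ+ → ℂ) {F : Sources} (hF : F ∈ sourceFiltration (-2))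
    {r : ℕ} (k : Fin r → ℤ) {P : Sources} {d : ℤ} (hP : P ∈ sourceFiltration d) :
    dressedOrdered b F k P ∈ sourceFiltration (d - r) := by
  have := prod_dressed_mem b hF (creationFirst k) hP
  rwa [length_creationFirst] at this

theorem dressedOrdered_one_sub_mem (b : ℕ+ → ℂ) {F : Sources} (hF : F ∈ sourceFiltration (-2))
    {r : ℕ} (k : Fin r → ℤ) :
    dressedOrdered b F k 1 - ∏ i, current b F (k i) ∈ sourceFiltration (2 - r) := by
  have := prod_dressed_sub_mem b hF (creationFirst k) one_mem_sourceFiltration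
  rw [length_creationFirst, prod_current_creationFirst, mul_one] at this
  exact sourceFiltration_anti (by omega) this

theorem dressedOrdered_connected_mem (b : ℕ+ → ℂ) {F : Sources}
    (hF : F ∈ sourceFiltration (-2)) {r : ℕ} (k : Fin r → ℤ) {P : Sources} {d : ℤ}
    (hP : P ∈ sourceFiltration d) :
    dressedOrdered b F k P - dressedOrdered b F k 1 * P -
      ∑ i, (∏ j ∈ Finset.univ.erase i, current b F (k j)) * sourceDeriv (k i) P ∈
        sourceFiltration (d - r + 4) := by
  have := prod_dressed_connected_mem b hF (creationFirst k) hP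
  rwa [length_creationFirst, singleContraction_creationFirst] at this

theorem vev_dressedOrdered_one (b : ℕ+ → ℂ) {F : Sources} (hF : F ∈ sourceFiltration (-2))
    {r : ℕ} (k : Fin r → ℤ) :
    (vev (dressedOrdered b F k 1)).coeff (-(r : ℤ)) = ∏ i, diskAmplitude b F (k i) := by
  have h := (prod_current_finset_mem b hF Finset.univ k).2
  rw [Finset.card_univ, Fintype.card_fin] at h
  rw [vev_coeff_congr (dressedOrdered_one_sub_mem b hF k) (by omega), h]

theorem vev_sourceDeriv_dressedOrdered_one (b : ℕ+ → ℂ) {F : Sources}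
    (hF : F ∈ sourceFiltration (-2)) (l : ℤ) {r : ℕ} (k : Fin r → ℤ) :
    (vev (sourceDeriv l (dressedOrdered b F k 1))).coeff (1 - (r : ℤ)) =
      ∑ i, (∏ j ∈ Finset.univ.erase i, diskAmplitude b F (k j)) *
        annulusAmplitude b F l (k i) := by
  have h := sourceDeriv_mem (dressedOrdered_one_sub_mem b hF k) l
  rw [map_sub, derivation_prod] at h
  rw [vev_coeff_congr h (by omega)]
  have := vev_sum_contraction b hF k (Q := fun i => sourceDeriv l (current b F (k i))) (e := 0)
    fun i => sourceFiltration_anti (by omega) (sourceDeriv_mem (current_mem b hF (k i)) l)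
  rwa [zero_add] at this

theorem vev_dressedOrdered_connected (b : ℕ+ → ℂ) {F : Sources}
    (hF : F ∈ sourceFiltration (-2)) {r : ℕ} (k : Fin r → ℤ) {P : Sources} {d : ℤ}
    (hP : P ∈ sourceFiltration d) :
    (vev (dressedOrdered b F k P - dressedOrdered b F k 1 * P)).coeff (d - r + 2) =
      ∑ i, (∏ j ∈ Finset.univ.erase i, diskAmplitude b F (k j)) *
        (vev (sourceDeriv (k i) P)).coeff (d + 1) := by
  rw [vev_coeff_congr (dressedOrdered_connected_mem b hF k hP) (by omega)]
  have := vev_sum_contraction b hF k (Q := fun i => sourceDeriv (k i) P) (e := d + 1)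
    fun i => sourceDeriv_mem hP (k i)
  rw [← this]
  congr 1
  omega

theorem vev_dressedOrdered_connected_eq_zero (b : ℕ+ → ℂ) {F : Sources}
    (hF : F ∈ sourceFiltration (-2)) {r : ℕ} (k : Fin r → ℤ) {P : Sources} {d i : ℤ}
    (hP : P ∈ sourceFiltration d) (hi : i < d - r + 2) :
    (vev (dressedOrdered b F k P - dressedOrdered b F k 1 * P)).coeff i = 0 := by
  have h1 := singleContraction_mem b hF (creationFirst k) hP
  rw [length_creationFirst, singleContraction_creationFirst] at h1
  have h2 := add_mem (sourceFiltration_anti (by omega) (dressedOrdered_connected_mem b hF k hP)) h1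
  rw [sub_add_cancel] at h2
  exact vev_mem h2 i hi

/-! ### Leading terms of the modes -/

theorem bosonIncrement_eq_X_mul {p : ℕ} (k : ℤ) :
    ∃ h : PowerSeries ℂ, bosonIncrement p k = PowerSeries.X * h ∧
      PowerSeries.constantCoeff h = (p : ℂ)⁻¹ := by
  refine ⟨PowerSeries.mk fun n => PowerSeries.coeff (n + 1) (bosonIncrement p k), ?_, ?_⟩
  · ext n
    cases n with
    | zero => simp [bosonIncrement]
    | succ n => rw [PowerSeries.coeff_succ_X_mul, PowerSeries.coeff_mk]
  · rw [← PowerSeries.coeff_zero_eq_constantCoeff_apply, PowerSeries.coeff_mk]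
    simp [bosonIncrement]

theorem constantCoeff_orderingFactor {p : ℕ} (hp : 0 < p) :
    PowerSeries.constantCoeff (orderingFactor p) = 1 := by
  have hp' : (p : ℂ) ≠ 0 := Nat.cast_ne_zero.mpr hp.ne'
  rw [orderingFactor, map_mul, map_mul, PowerSeries.constantCoeff_inv,
    ← PowerSeries.coeff_zero_eq_constantCoeff_apply (PowerSeries.mk _), PowerSeries.coeff_mk]
  simp [hp']

/-- Each increment begins with `u / p` whatever its index, so `s` of them already exhaust `u^s`, and
of the ordering factor only the constant term 1 remains. This makes the leading sums plain
convolutions. -/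
theorem modeWeight_self {p : ℕ} (hp : 0 < p) {s : ℕ} (k : Fin s → ℤ) :
    modeWeight p s k = p * ((p : ℂ) ^ s)⁻¹ := by
  choose h hX h0 using fun i => bosonIncrement_eq_X_mul (p := p) (k i)
  have hs : ((s ! : ℕ) : ℂ) ≠ 0 := Nat.cast_ne_zero.mpr (Nat.factorial_ne_zero s)
  have e : orderingFactor p * ∏ i, bosonIncrement p (k i) =
      PowerSeries.X ^ s * (orderingFactor p * ∏ i, h i) := by
    simp_rw [hX, Finset.prod_mul_distrib, Finset.prod_const, Finset.card_univ, Fintype.card_fin]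
    ring
  have e2 := PowerSeries.coeff_X_pow_mul (orderingFactor p * ∏ i, h i) s 0
  rw [zero_add, PowerSeries.coeff_zero_eq_constantCoeff_apply,
    map_mul PowerSeries.constantCoeff, map_prod, constantCoeff_orderingFactor hp] at e2
  rw [modeWeight, e, e2, mul_div_assoc, div_self hs]
  simp [h0]

theorem coeff_coeff_dressedMode (p : ℕ) {b : ℕ+ → ℂ} {B : ℕ}
    (hb : ∀ n : ℕ+, B < (n : ℕ) → b n = 0) (F : Sources) (s : ℕ) (n : ℤ) (P : Sources)
    (J : ℕ+ →₀ ℕ) (i : ℤ) :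
    (MvPowerSeries.coeff J (dressedMode p b F s n P)).coeff i =
      ∑ r ∈ Finset.range (s + 1), ∑ᶠ k ∈ {k : Fin r → ℤ | ∑ i, k i = p * n},
        modeWeight p s k * (MvPowerSeries.coeff J (dressedOrdered b F k P)).coeff i := by
  rw [coeff_dressedMode, HahnSeries.coeff_sum]
  refine Finset.sum_congr rfl fun r _ => ?_
  rw [← HahnSeries.coeff.addMonoidHom_apply, AddMonoidHom.map_finsum_mem' _
    (finite_support_dressedMode hb F r (p * n) P J _)]
  refine finsum_mem_congr rfl fun k _ => ?_
  rw [HahnSeries.coeff.addMonoidHom_apply, HahnSeries.C_mul_eq_smul, HahnSeries.coeff_smul,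
    smul_eq_mul]

theorem dressedMode_mem (p : ℕ) {b : ℕ+ → ℂ} {B : ℕ}
    (hb : ∀ n : ℕ+, B < (n : ℕ) → b n = 0) {F : Sources} (hF : F ∈ sourceFiltration (-2))
    (s : ℕ) (n : ℤ) {P : Sources} {d : ℤ} (hP : P ∈ sourceFiltration d) :
    dressedMode p b F s n P ∈ sourceFiltration (d - s) := by
  intro J i hi
  rw [coeff_coeff_dressedMode p hb]
  refine Finset.sum_eq_zero fun r hr => ?_
  rw [Finset.mem_range] at hr
  refine finsum_mem_eq_zero_of_forall_eq_zero fun k _ => ?_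
  rw [dressedOrdered_mem b hF k hP J i (by omega), mul_zero]

theorem modeSeries_mem (p : ℕ) {b : ℕ+ → ℂ} {B : ℕ}
    (hb : ∀ n : ℕ+, B < (n : ℕ) → b n = 0) {F : Sources} (hF : F ∈ sourceFiltration (-2))
    (s : ℕ) (n : ℤ) : modeSeries p b F s n ∈ sourceFiltration (-(s : ℤ)) := by
  simpa [modeSeries] using dressedMode_mem p hb hF s n one_mem_sourceFiltration

theorem sum_range_succ_eq_last {s : ℕ} (n : ℤ) (p : ℕ) (x : ∀ r : ℕ, (Fin r → ℤ) → ℂ)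
    (h : ∀ r < s, ∀ k, x r k = 0) :
    ∑ r ∈ Finset.range (s + 1), ∑ᶠ k ∈ {k : Fin r → ℤ | ∑ i, k i = p * n}, x r k =
      ∑ᶠ k ∈ {k : Fin s → ℤ | ∑ i, k i = p * n}, x s k := by
  rw [Finset.sum_range_succ, Finset.sum_eq_zero, zero_add]
  intro r hr
  exact finsum_mem_eq_zero_of_forall_eq_zero fun k _ => h r (Finset.mem_range.mp hr) k

theorem vev_eq_coeff (P : Sources) : vev P = MvPowerSeries.coeff 0 P := by
  rw [vev, MvPowerSeries.coeff_zero_eq_constantCoeff_apply]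

theorem vev_sourceDeriv (m : ℕ+) (P : Sources) :
    vev (sourceDeriv m P) = MvPowerSeries.coeff (Finsupp.single m 1) P := by
  obtain ⟨n, rfl⟩ : ∃ n : ℕ, m = n.succPNat := ⟨m.natPred, by simp⟩
  rw [vev_eq_coeff]
  change MvPowerSeries.coeff 0 (MvPowerSeries.pderiv Coupling n.succPNat P) = _
  rw [MvPowerSeries.coeff_pderiv]
  simp

/-- Monomials of degree `r < s` start at `g^(-r)` and do not reach `g^(-s)`. -/
theorem vev_modeSeries {p : ℕ} (hp : 0 < p) {b : ℕ+ → ℂ} {B : ℕ}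
    (hb : ∀ n : ℕ+, B < (n : ℕ) → b n = 0) {F : Sources} (hF : F ∈ sourceFiltration (-2))
    (s : ℕ) (n : ℤ) :
    (vev (modeSeries p b F s n)).coeff (-(s : ℤ)) =
      p * ((p : ℂ) ^ s)⁻¹ * ∑ᶠ k ∈ {k : Fin s → ℤ | ∑ i, k i = p * n},
        ∏ i, diskAmplitude b F (k i) := by
  rw [vev_eq_coeff, modeSeries, coeff_coeff_dressedMode p hb, sum_range_succ_eq_last,
    mul_finsum_mem]
  · refine finsum_mem_congr rfl fun k _ => ?_
    rw [modeWeight_self hp, ← vev_eq_coeff, vev_dressedOrdered_one b hF]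
  · intro r hr k
    rw [← vev_eq_coeff, vev_mem (dressedOrdered_mem b hF k one_mem_sourceFiltration) _ (by omega),
      mul_zero]

theorem vev_sourceDeriv_modeSeries {p : ℕ} (hp : 0 < p) {b : ℕ+ → ℂ} {B : ℕ}
    (hb : ∀ n : ℕ+, B < (n : ℕ) → b n = 0) {F : Sources} (hF : F ∈ sourceFiltration (-2))
    (m : ℕ+) (t : ℕ) (n : ℤ) :
    (vev (sourceDeriv m (modeSeries p b F t n))).coeff (1 - (t : ℤ)) =
      p * ((p : ℂ) ^ t)⁻¹ * ∑ᶠ k ∈ {k : Fin t → ℤ | ∑ i, k i = p * n},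
        ∑ i, (∏ j ∈ Finset.univ.erase i, diskAmplitude b F (k j)) *
          annulusAmplitude b F m (k i) := by
  rw [vev_sourceDeriv, modeSeries, coeff_coeff_dressedMode p hb, sum_range_succ_eq_last,
    mul_finsum_mem]
  · refine finsum_mem_congr rfl fun k _ => ?_
    rw [modeWeight_self hp, ← vev_sourceDeriv, vev_sourceDeriv_dressedOrdered_one b hF]
  · intro r hr k
    rw [← vev_sourceDeriv, vev_mem (sourceDeriv_mem
      (dressedOrdered_mem b hF k one_mem_sourceFiltration) _) _ (by omega), mul_zero]

theorem vev_dressedMode_connected {p : ℕ} (hp : 0 < p) {b : ℕ+ → ℂ} {B : ℕ}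
    (hb : ∀ n : ℕ+, B < (n : ℕ) → b n = 0) {F : Sources} (hF : F ∈ sourceFiltration (-2))
    (s : ℕ) (n : ℤ) {P : Sources} {d : ℤ} (hP : P ∈ sourceFiltration d) :
    (vev (dressedMode p b F s n P - modeSeries p b F s n * P)).coeff (d - s + 2) =
      p * ((p : ℂ) ^ s)⁻¹ * ∑ᶠ k ∈ {k : Fin s → ℤ | ∑ i, k i = p * n},
        ∑ i, (∏ j ∈ Finset.univ.erase i, diskAmplitude b F (k j)) *
          (vev (sourceDeriv (k i) P)).coeff (d + 1) := by
  have hfin : ∀ r, ({k : Fin r → ℤ | ∑ i, k i = p * n} ∩ Function.support fun k =>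
      HahnSeries.C (modeWeight p s k) *
          vev (dressedOrdered b F k P - dressedOrdered b F k 1 * P)).Finite := by
    intro r
    refine ((finite_coeff_dressedOrdered hb F r (p * n) P 0).union
      (finite_coeff_dressedOrdered hb F r (p * n) 1 0)).subset ?_
    intro k hk
    by_contra h'
    simp only [Set.mem_union, Set.mem_ofPred_eq, not_or, not_and, not_not] at h'
    refine hk.2 ?_
    have e : vev (dressedOrdered b F k P - dressedOrdered b F k 1 * P) =
        vev (dressedOrdered b F k P) - vev (dressedOrdered b F k 1) * vev P := by
      rw [← vev_mul]; exact map_sub _ _ _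
    simp only
    rw [e, vev_eq_coeff, vev_eq_coeff (dressedOrdered b F k 1), h'.1 hk.1, h'.2 hk.1]
    simp
  have h : vev (dressedMode p b F s n P - modeSeries p b F s n * P) =
      ∑ r ∈ Finset.range (s + 1), ∑ᶠ k ∈ {k : Fin r → ℤ | ∑ i, k i = p * n},
        HahnSeries.C (modeWeight p s k) *
          vev (dressedOrdered b F k P - dressedOrdered b F k 1 * P) := by
    have h1 : vev (dressedMode p b F s n P - modeSeries p b F s n * P) =
        vev (dressedMode p b F s n P) - vev (modeSeries p b F s n) * vev P := by
      rw [← vev_mul]; exact map_sub _ _ _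
    rw [h1, vev_eq_coeff, vev_eq_coeff (modeSeries p b F s n), modeSeries, coeff_dressedMode,
      coeff_dressedMode, Finset.sum_mul, ← Finset.sum_sub_distrib]
    refine Finset.sum_congr rfl fun r _ => ?_
    have hfin1 := finite_support_dressedMode hb F r (p * n) 1 0
      fun k => HahnSeries.C (modeWeight p s k)
    rw [finsum_mem_mul, sub_eq_iff_eq_add, ← finsum_mem_add_distrib' (hfin r)
      (hfin1.subset fun k hk => ⟨hk.1, left_ne_zero_of_mul hk.2⟩)]
    refine finsum_mem_congr rfl fun k _ => ?_
    have e : vev (dressedOrdered b F k P - dressedOrdered b F k 1 * P) =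
        vev (dressedOrdered b F k P) - vev (dressedOrdered b F k 1) * vev P := by
      rw [← vev_mul]; exact map_sub _ _ _
    rw [e]
    simp only [← vev_eq_coeff]
    ring
  rw [h, HahnSeries.coeff_sum]
  have h2 : ∀ r, (∑ᶠ k ∈ {k : Fin r → ℤ | ∑ i, k i = p * n}, HahnSeries.C (modeWeight p s k) *
      vev (dressedOrdered b F k P - dressedOrdered b F k 1 * P)).coeff (d - s + 2) =
      ∑ᶠ k ∈ {k : Fin r → ℤ | ∑ i, k i = p * n}, modeWeight p s k *
        (vev (dressedOrdered b F k P - dressedOrdered b F k 1 * P)).coeff (d - s + 2) := by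
    intro r
    rw [← HahnSeries.coeff.addMonoidHom_apply, AddMonoidHom.map_finsum_mem' _ (hfin r)]
    refine finsum_mem_congr rfl fun k _ => ?_
    rw [HahnSeries.coeff.addMonoidHom_apply, HahnSeries.C_mul_eq_smul, HahnSeries.coeff_smul,
      smul_eq_mul]
  simp_rw [h2]
  rw [sum_range_succ_eq_last, mul_finsum_mem]
  · refine finsum_mem_congr rfl fun k _ => ?_
    rw [modeWeight_self hp, vev_dressedOrdered_connected b hF k hP]
  · intro r hr k
    rw [vev_dressedOrdered_connected_eq_zero b hF k hP (by omega), mul_zero]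

/-! ### Laurent series and the Euler operator -/

theorem exists_laurentSeries (x : ℤ → ℂ) (m : ℤ) (h : ∀ k < m, x k = 0) :
    ∃ X : LaurentSeries ℂ, ∀ k, X.coeff k = x k := by
  refine ⟨HahnSeries.ofSuppBddBelow x ⟨m, fun k hk => ?_⟩, fun k => rfl⟩
  by_contra! h'
  exact hk (h k h')

theorem exists_coeff_eq_zero_of_lt_neg (x : LaurentSeries ℂ) :
    ∃ C : ℕ, ∀ k < -(C : ℤ), x.coeff k = 0 :=
  ⟨(-x.order).toNat, fun k hk => HahnSeries.coeff_eq_zero_of_lt_order (by omega)⟩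

theorem coeff_mul_eq_sum_Icc {x y : LaurentSeries ℂ} {N lo hi : ℤ}
    (hx : ∀ k < lo, x.coeff k = 0) (hy : ∀ k, hi < k → y.coeff (N - k) = 0) :
    (x * y).coeff N = ∑ k ∈ Finset.Icc lo hi, x.coeff k * y.coeff (N - k) := by
  rw [HahnSeries.coeff_mul]
  refine Finset.sum_of_injOn Prod.fst ?_ ?_ ?_ ?_
  · intro i hi j hj hij
    simp only [Finset.mem_coe, Finset.mem_antidiagonal] at hi hj
    have := hi.2.2
    have := hj.2.2
    exact Prod.ext hij (by omega)
  · intro i hi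
    simp only [Finset.mem_coe, Finset.mem_antidiagonal] at hi
    have h3 := hi.2.2
    simp only [Finset.coe_Icc, Set.mem_Icc]
    constructor
    · by_contra! h
      exact hi.1 (hx _ h)
    · by_contra! h
      refine hi.2.1 ?_
      rw [show i.2 = N - i.1 by omega]
      exact hy _ h
  · intro k _ hk
    by_contra h
    refine hk ⟨(k, N - k), ?_, rfl⟩
    simp only [Finset.mem_coe, Finset.mem_antidiagonal]
    exact ⟨left_ne_zero_of_mul h, right_ne_zero_of_mul h, by omega⟩
  · intro i hi
    simp only [Finset.mem_antidiagonal] at hi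
    rw [show i.2 = N - i.1 by have := hi.2.2; omega]

/-- The Euler operator, multiplying the coefficient of `Xᵏ` by `k`. -/
def euler (x : LaurentSeries ℂ) : LaurentSeries ℂ :=
  HahnSeries.ofSuppBddBelow (fun k => (k : ℂ) * x.coeff k) ⟨x.order, fun k hk => by
    by_contra! h
    refine hk ?_
    simp only
    rw [HahnSeries.coeff_eq_zero_of_lt_order h, mul_zero]⟩

theorem coeff_euler (x : LaurentSeries ℂ) (k : ℤ) : (euler x).coeff k = k * x.coeff k := rfl

theorem euler_mul (x y : LaurentSeries ℂ) : euler (x * y) = euler x * y + x * euler y := by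
  ext N
  obtain ⟨C, hC⟩ := exists_coeff_eq_zero_of_lt_neg x
  obtain ⟨D, hD⟩ := exists_coeff_eq_zero_of_lt_neg y
  have hy : ∀ k, N + D < k → y.coeff (N - k) = 0 := fun k hk => hD _ (by omega)
  rw [coeff_euler, HahnSeries.coeff_add, coeff_mul_eq_sum_Icc hC hy,
    coeff_mul_eq_sum_Icc (x := euler x) (fun k hk => by rw [coeff_euler, hC k hk, mul_zero]) hy,
    coeff_mul_eq_sum_Icc (y := euler y) hC (fun k hk => by rw [coeff_euler, hy k hk, mul_zero]),
    ← Finset.sum_add_distrib, Finset.mul_sum]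
  refine Finset.sum_congr rfl fun k _ => ?_
  rw [coeff_euler, coeff_euler]
  push_cast
  ring

theorem euler_pow_succ (y : LaurentSeries ℂ) (n : ℕ) :
    euler (y ^ (n + 1)) = (n + 1) * (y ^ n * euler y) := by
  induction n with
  | zero => simp
  | succ n ih =>
    rw [pow_succ, euler_mul, ih]
    push_cast
    ring

theorem euler_one : euler 1 = 0 := by
  ext k
  rw [coeff_euler, HahnSeries.coeff_one]
  split_ifs with h <;> simp [h]

/-- The Euler operator is a derivation, so both sides are `m (m + n) y ^ (m + n - 1)` times `euler
y`. Without division the case `m = n = 0` is included. -/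
theorem add_smul_euler_pow_mul (y : LaurentSeries ℂ) (m n : ℕ) :
    ((m : LaurentSeries ℂ) + n) * (euler (y ^ m) * y ^ n) = m * euler (y ^ (m + n)) := by
  cases m with
  | zero => simp [euler_one]
  | succ m =>
    rw [euler_pow_succ, show m + 1 + n = m + n + 1 by ring, euler_pow_succ]
    push_cast
    ring

/-! ### Sums over tuples as coefficients of products -/

/-- The tuples of integers bounded below by `-C` with sum `N`. -/
def boundedTuples (r : ℕ) (N : ℤ) (C : ℕ) : Finset (Fin r → ℤ) :=
  (Fintype.piFinset fun _ : Fin r => Finset.Icc (-(C : ℤ)) (N + r * C)).filter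
    fun k => ∑ i, k i = N

theorem mem_boundedTuples {r : ℕ} {N : ℤ} {C : ℕ} {k : Fin r → ℤ} :
    k ∈ boundedTuples r N C ↔ (∀ i, -(C : ℤ) ≤ k i) ∧ ∑ i, k i = N := by
  rw [boundedTuples, Finset.mem_filter, Fintype.mem_piFinset]
  refine ⟨fun h => ⟨fun i => (Finset.mem_Icc.mp (h.1 i)).1, h.2⟩, fun h => ⟨fun i => ?_, h.2⟩⟩
  refine Finset.mem_Icc.mpr ⟨h.1 i, ?_⟩
  have h1 : ∑ j, (k j + C) = N + r * C := by
    rw [Finset.sum_add_distrib, h.2]; simp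
  have h2 : k i + C ≤ ∑ j, (k j + C) :=
    Finset.single_le_sum (f := fun j => k j + (C : ℤ)) (fun j _ => by have := h.1 j; omega)
      (Finset.mem_univ i)
  omega

theorem prod_single {ι : Type*} (S : Finset ι) (k : ι → ℤ) (x : ι → ℂ) :
    ∏ i ∈ S, HahnSeries.single (k i) (x i) =
      HahnSeries.single (∑ i ∈ S, k i) (∏ i ∈ S, x i) := by
  classical
  induction S using Finset.induction_on with
  | empty => simp
  | insert a S ha ih =>
    rw [Finset.prod_insert ha, Finset.prod_insert ha, Finset.sum_insert ha, ih,
      HahnSeries.single_mul_single]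

theorem prod_mem_couplingFiltration {ι : Type*} (S : Finset ι) {f : ι → Coupling} {C : ℕ}
    (hf : ∀ i, f i ∈ couplingFiltration (-(C : ℤ))) :
    ∏ i ∈ S, f i ∈ couplingFiltration (-(S.card * C : ℤ)) := by
  classical
  induction S using Finset.induction_on with
  | empty =>
    intro i hi
    simp at hi
    rw [Finset.prod_empty, HahnSeries.coeff_one, if_neg (by omega)]
  | insert a S ha ih =>
    rw [Finset.prod_insert ha, Finset.card_insert_of_notMem ha]
    refine couplingFiltration_anti (le_of_eq ?_) (mul_mem_couplingFiltration (hf a) ih)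
    push_cast; ring

theorem prod_sub_prod_mem_couplingFiltration {ι : Type*} (S : Finset ι) {f g : ι → Coupling}
    {C : ℕ} {e : ℤ} (hf : ∀ i, f i ∈ couplingFiltration (-(C : ℤ)))
    (hg : ∀ i, g i ∈ couplingFiltration (-(C : ℤ)))
    (hfg : ∀ i, f i - g i ∈ couplingFiltration e) :
    ∏ i ∈ S, f i - ∏ i ∈ S, g i ∈ couplingFiltration (e - S.card * C) := by
  classical
  induction S using Finset.induction_on with
  | empty => simp
  | insert a S ha ih =>
    rw [Finset.prod_insert ha, Finset.prod_insert ha, Finset.card_insert_of_notMem ha]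
    have h : f a * ∏ i ∈ S, f i - g a * ∏ i ∈ S, g i =
        (f a - g a) * ∏ i ∈ S, f i + g a * (∏ i ∈ S, f i - ∏ i ∈ S, g i) := by ring
    rw [h]
    refine add_mem (couplingFiltration_anti ?_ (mul_mem_couplingFiltration (hfg a)
        (prod_mem_couplingFiltration S hf)))
      (couplingFiltration_anti ?_ (mul_mem_couplingFiltration (hg a) ih))
    · push_cast; linarith
    · push_cast; linarith

theorem sum_boundedTuples {r : ℕ} (N : ℤ) {C : ℕ} {f : Fin r → LaurentSeries ℂ}
    (hf : ∀ i, ∀ k < -(C : ℤ), (f i).coeff k = 0) :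
    ∑ k ∈ boundedTuples r N C, ∏ i, (f i).coeff (k i) = (∏ i, f i).coeff N := by
  set I := Finset.Icc (-(C : ℤ)) (N + r * C) with hI
  set g : Fin r → LaurentSeries ℂ := fun i =>
    ∑ m ∈ I, HahnSeries.single m ((f i).coeff m) with hg
  have hgc : ∀ i k, (g i).coeff k = if k ∈ I then (f i).coeff k else 0 := by
    intro i k
    rw [hg]
    simp only [HahnSeries.coeff_sum]
    split_ifs with h
    · rw [Finset.sum_eq_single_of_mem k h fun m _ hm => HahnSeries.coeff_single_of_ne hm.symm,
        HahnSeries.coeff_single_same]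
    · refine Finset.sum_eq_zero fun m hm => HahnSeries.coeff_single_of_ne ?_
      rintro rfl
      exact h hm
  have hg' : ∀ i, g i ∈ couplingFiltration (-(C : ℤ)) := by
    intro i k hk
    rw [hgc, hf i k hk, ite_self]
  -- The cut is high enough that the remaining factors, of order at least `-C` each, cannot bring
  -- the error down to the exponent `N`.
  have hfg : ∀ i, f i - g i ∈ couplingFiltration (N + r * C + 1) := by
    intro i k hk
    rw [HahnSeries.coeff_sub, hgc]
    split_ifs with h
    · exact sub_self _
    · rw [sub_zero]
      refine hf i k ?_
      rw [hI, Finset.mem_Icc] at h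
      omega
  have h1 : (∏ i, f i).coeff N = (∏ i, g i).coeff N := by
    have := prod_sub_prod_mem_couplingFiltration Finset.univ hf hg' hfg N
      (by rw [Finset.card_univ, Fintype.card_fin]; omega)
    rwa [HahnSeries.coeff_sub, sub_eq_zero] at this
  rw [h1, hg, Finset.prod_univ_sum, HahnSeries.coeff_sum, boundedTuples, Finset.sum_filter]
  refine Finset.sum_congr rfl fun k _ => ?_
  rw [prod_single]
  split_ifs with h
  · rw [h, HahnSeries.coeff_single_same]
  · rw [HahnSeries.coeff_single_of_ne (Ne.symm h)]

theorem finsum_prod_coeff {r : ℕ} (N : ℤ) (y : LaurentSeries ℂ) :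
    ∑ᶠ k ∈ {k : Fin r → ℤ | ∑ i, k i = N}, ∏ i, y.coeff (k i) = (y ^ r).coeff N := by
  obtain ⟨C, hC⟩ := exists_coeff_eq_zero_of_lt_neg y
  rw [finsum_mem_eq_sum_of_subset (t := boundedTuples r N C), sum_boundedTuples N fun _ => hC]
  · simp
  · rintro k ⟨hN, hk⟩
    refine mem_boundedTuples.mpr ⟨fun i => ?_, hN⟩
    by_contra! h
    exact hk (Finset.prod_eq_zero (Finset.mem_univ i) (hC _ h))
  · exact fun k hk => (mem_boundedTuples.mp hk).2

theorem finsum_sum_prod_coeff {r : ℕ} (N : ℤ) (x y : LaurentSeries ℂ) :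
    ∑ᶠ k ∈ {k : Fin (r + 1) → ℤ | ∑ i, k i = N},
      ∑ i, (∏ j ∈ Finset.univ.erase i, y.coeff (k j)) * x.coeff (k i) =
      (r + 1) * (x * y ^ r).coeff N := by
  obtain ⟨C, hC⟩ := exists_coeff_eq_zero_of_lt_neg x
  obtain ⟨D, hD⟩ := exists_coeff_eq_zero_of_lt_neg y
  have hf : ∀ i j : Fin (r + 1), ∀ k < -((max C D : ℕ) : ℤ),
      ((Function.update (fun _ => y) i x : Fin (r + 1) → LaurentSeries ℂ) j).coeff k = 0 := by
    intro i j k hk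
    push_cast at hk
    rcases eq_or_ne j i with rfl | h
    · rw [Function.update_self]; exact hC k (by omega)
    · rw [Function.update_of_ne h]; exact hD k (by omega)
  -- Placing `x` at the marked position `i` gives a convolution for each `i`, and all `r + 1` of
  -- them have the same product.
  have hterm : ∀ (k : Fin (r + 1) → ℤ) (i : Fin (r + 1)),
      (∏ j ∈ Finset.univ.erase i, y.coeff (k j)) * x.coeff (k i) =
      ∏ j, ((Function.update (fun _ => y) i x : Fin (r + 1) → LaurentSeries ℂ) j).coeff (k j) := by
    intro k i
    rw [← Finset.prod_erase_mul _ _ (Finset.mem_univ i), Function.update_self]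
    congr 1
    refine Finset.prod_congr rfl fun j hj => ?_
    rw [Function.update_of_ne (Finset.ne_of_mem_erase hj)]
  have hprod : ∀ i : Fin (r + 1),
      ∏ j, (Function.update (fun _ => y) i x : Fin (r + 1) → LaurentSeries ℂ) j = x * y ^ r := by
    intro i
    rw [Finset.prod_update_of_mem (Finset.mem_univ i), Finset.prod_const,
      Finset.card_sdiff_of_subset (by simp)]
    simp
  simp_rw [hterm]
  rw [finsum_mem_eq_sum_of_subset (t := boundedTuples (r + 1) N (max C D)), Finset.sum_comm,
    Finset.sum_congr rfl fun i _ => sum_boundedTuples N (hf i)]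
  · simp [hprod]
  · rintro k ⟨hN, hk⟩
    refine mem_boundedTuples.mpr ⟨fun j => ?_, hN⟩
    by_contra! h
    exact hk (Finset.sum_eq_zero fun i _ =>
      Finset.prod_eq_zero (Finset.mem_univ j) (hf i j _ h))
  · exact fun k hk => (mem_boundedTuples.mp hk).2

/-! ### Detection of a series and the commutator of pairings -/

/-- If `x ≠ 0`, the order `x.order - j e` of `x * y ^ j` is a multiple of `p` for a suitable `j`,
because `e` is invertible modulo `p`. The hypothesis then kills a lowest coefficient, which is
absurd. -/
theorem eq_zero_of_forall_coeff_mul_pow {p e : ℕ} (hp : 0 < p) (hpe : p.Coprime e)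
    {x y : LaurentSeries ℂ} (hy : y.order = -(e : ℤ)) (hy0 : y ≠ 0)
    (h : ∀ (j : ℕ) (n : ℤ), (x * y ^ j).coeff (p * n) = 0) : x = 0 := by
  by_contra hx
  -- Bézout makes `z * e` congruent to `x.order` modulo `p`; reduction modulo `p` turns `z` into a
  -- natural exponent.
  set z : ℤ := x.order * Nat.gcdB p e with hz
  have hbez : (p : ℤ) * Nat.gcdA p e + e * Nat.gcdB p e = 1 := by
    rw [← Nat.gcd_eq_gcd_ab, hpe.gcd_eq_one]; simp
  have hj : (((z % p).toNat : ℕ) : ℤ) = z % p :=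
    Int.toNat_of_nonneg (Int.emod_nonneg _ (by omega))
  have hne : x * y ^ (z % p).toNat ≠ 0 := mul_ne_zero hx (pow_ne_zero _ hy0)
  refine HahnSeries.coeff_order_eq_zero.not.mpr hne ?_
  have hord : (x * y ^ (z % p).toNat).order =
      p * (x.order * Nat.gcdA p e + (z / p) * e) := by
    rw [HahnSeries.order_mul hx (pow_ne_zero _ hy0), HahnSeries.order_pow, hy, nsmul_eq_mul, hj]
    have := Int.emod_add_mul_ediv z p
    rw [show z % p = z - p * (z / p) by omega, hz]
    linear_combination (-x.order) * hbez
  rw [hord]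
  exact h _ _

/-- The bilinear pairing in the leading term of the connected two point function of two currents,
where `G k` is the generating series of the two point functions of `αₖ` with the oscillators, is
symmetric up to the contribution of the commutator of the oscillators. -/
theorem pairing_sub_pairing {G : ℤ → LaurentSeries ℂ}
    (hG : ∀ k, 1 ≤ k → ∀ l, l ≤ 0 → (G k).coeff l = if l = -k then (k : ℂ) else 0)
    (hsymm : ∀ k l, 1 ≤ k → 1 ≤ l → (G k).coeff l = (G l).coeff k)
    {f h A A' : LaurentSeries ℂ} {N M : ℤ}
    (hA : ∀ k, A.coeff k = if 1 ≤ k then (G k * h).coeff M else 0)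
    (hA' : ∀ k, A'.coeff k = if 1 ≤ k then (G k * f).coeff N else 0) :
    (A * f).coeff N - (A' * h).coeff M =
      (euler h * f).coeff (N + M) - M * (h * f).coeff (N + M) := by
  obtain ⟨C₁, hC₁⟩ := exists_coeff_eq_zero_of_lt_neg f
  obtain ⟨C₂, hC₂⟩ := exists_coeff_eq_zero_of_lt_neg h
  obtain ⟨C, hCf, hCh⟩ : ∃ C : ℕ, (∀ k, (C : ℤ) < k → f.coeff (N - k) = 0) ∧
      ∀ k, (C : ℤ) < k → h.coeff (M - k) = 0 :=
    ⟨(max (C₁ + N) (C₂ + M)).toNat, fun k hk => hC₁ _ (by omega), fun k hk => hC₂ _ (by omega)⟩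
  -- Splitting `G k` at index 0 separates the creation part, a single term at `-k`, from a double
  -- sum over positive indices.
  have key : ∀ {f h A : LaurentSeries ℂ} {N M : ℤ},
      (∀ k, A.coeff k = if 1 ≤ k then (G k * h).coeff M else 0) →
      (∀ k, (C : ℤ) < k → f.coeff (N - k) = 0) → (∀ k, (C : ℤ) < k → h.coeff (M - k) = 0) →
      (A * f).coeff N = ∑ k ∈ Finset.Icc (1 : ℤ) C, k * h.coeff (M + k) * f.coeff (N - k) +
        ∑ k ∈ Finset.Icc (1 : ℤ) C, ∑ l ∈ Finset.Icc (1 : ℤ) C,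
          (G k).coeff l * h.coeff (M - l) * f.coeff (N - k) := by
    intro f h A N M hA hCf hCh
    rw [coeff_mul_eq_sum_Icc (lo := 1) (fun k hk => by rw [hA, if_neg (by omega)]) hCf,
      ← Finset.sum_add_distrib]
    refine Finset.sum_congr rfl fun k hk => ?_
    rw [Finset.mem_Icc] at hk
    rw [hA, if_pos hk.1, coeff_mul_eq_sum_Icc (lo := -k) (hi := C) (fun l hl => ?_) hCh]
    · have hsplit : Finset.Icc (-k) (C : ℤ) = Finset.Icc (-k) 0 ∪ Finset.Icc 1 (C : ℤ) := by
        ext l; simp only [Finset.mem_union, Finset.mem_Icc]; omega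
      have hdisj : Disjoint (Finset.Icc (-k) 0) (Finset.Icc 1 (C : ℤ)) := by
        rw [Finset.disjoint_left]; intro l; simp only [Finset.mem_Icc]; omega
      rw [hsplit, Finset.sum_union hdisj, add_mul, Finset.sum_mul,
        Finset.sum_eq_single_of_mem (-k) (by simp only [Finset.mem_Icc]; omega)]
      · rw [hG k hk.1 _ (by omega), if_pos rfl, sub_neg_eq_add, Finset.sum_mul]
      · intro l hl hne
        rw [hG k hk.1 l (Finset.mem_Icc.mp hl).2, if_neg hne, zero_mul, zero_mul]
    · rw [hG k hk.1 l (by omega), if_neg (by omega)]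
  rw [key hA hCf hCh, key hA' hCh hCf]
  -- The double sums agree by the symmetry of `G` and cancel. The two creation parts combine into
  -- one sum over all integers, which is the Euler term.
  have hsw : ∑ k ∈ Finset.Icc (1 : ℤ) C, ∑ l ∈ Finset.Icc (1 : ℤ) C,
      (G k).coeff l * f.coeff (N - l) * h.coeff (M - k) =
      ∑ k ∈ Finset.Icc (1 : ℤ) C, ∑ l ∈ Finset.Icc (1 : ℤ) C,
        (G k).coeff l * h.coeff (M - l) * f.coeff (N - k) := by
    rw [Finset.sum_comm]
    refine Finset.sum_congr rfl fun k hk => Finset.sum_congr rfl fun l hl => ?_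
    rw [hsymm l k (Finset.mem_Icc.mp hl).1 (Finset.mem_Icc.mp hk).1]
    ring
  have hright : (euler h * f).coeff (N + M) - M * (h * f).coeff (N + M) =
      ∑ k ∈ Finset.Icc (-(C : ℤ)) C, (k : ℂ) * h.coeff (M + k) * f.coeff (N - k) := by
    have hlo : ∀ k < M - C, h.coeff k = 0 := fun k hk => by
      have := hCh (M - k) (by omega)
      rwa [sub_sub_cancel] at this
    have hhi : ∀ k, M + C < k → f.coeff (N + M - k) = 0 := fun k hk => by
      have := hCf (k - M) (by omega)
      rwa [show N + M - k = N - (k - M) by ring]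
    rw [coeff_mul_eq_sum_Icc (x := euler h)
      (fun k hk => by rw [coeff_euler, hlo k hk, mul_zero]) hhi, coeff_mul_eq_sum_Icc hlo hhi,
      Finset.mul_sum, ← Finset.sum_sub_distrib]
    refine Finset.sum_nbij' (fun k => k - M) (fun k => M + k) ?_ ?_ ?_ ?_ ?_
    · intro k; simp only [Finset.mem_Icc]; omega
    · intro k; simp only [Finset.mem_Icc]; omega
    · intro k _; ring
    · intro k _; ring
    · intro k _
      rw [coeff_euler, show M + (k - M) = k by ring, show N - (k - M) = N + M - k by ring]
      push_cast
      ring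
  have hsplit : Finset.Icc (-(C : ℤ)) C =
      Finset.Icc (-(C : ℤ)) (-1) ∪ ({0} ∪ Finset.Icc 1 (C : ℤ)) := by
    ext l; simp only [Finset.mem_union, Finset.mem_Icc, Finset.mem_singleton]; omega
  have hdisj : Disjoint (Finset.Icc (-(C : ℤ)) (-1)) ({0} ∪ Finset.Icc 1 (C : ℤ)) := by
    rw [Finset.disjoint_left]; intro l
    simp only [Finset.mem_union, Finset.mem_Icc, Finset.mem_singleton]; omega
  have hneg : ∑ k ∈ Finset.Icc (-(C : ℤ)) (-1), (k : ℂ) * h.coeff (M + k) * f.coeff (N - k) =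
      -∑ k ∈ Finset.Icc (1 : ℤ) C, (k : ℂ) * f.coeff (N + k) * h.coeff (M - k) := by
    rw [← Finset.sum_neg_distrib]
    refine Finset.sum_nbij' (fun k => -k) (fun k => -k) ?_ ?_ ?_ ?_ ?_
    · intro k; simp only [Finset.mem_Icc]; omega
    · intro k; simp only [Finset.mem_Icc]; omega
    · intro k _; ring
    · intro k _; ring
    · intro k _
      rw [sub_neg_eq_add, ← sub_eq_add_neg]
      push_cast
      ring
  rw [hsw, hright, hsplit, Finset.sum_union hdisj, Finset.sum_union (by simp), hneg]
  simp
  ring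

/-! ### Explicit and symmetric values of the amplitudes -/

theorem current_neg (b : ℕ+ → ℂ) (F : Sources) (m : ℕ+) :
    current b F (-(m : ℤ)) = (m : ℕ) •
      (MvPowerSeries.C (HahnSeries.single (-1 : ℤ) (b m)) + MvPowerSeries.X m) := by
  obtain ⟨n, rfl⟩ : ∃ n : ℕ, m = n.succPNat := ⟨m.natPred, by simp⟩
  have : (-((n.succPNat : ℕ+) : ℤ)) = Int.negSucc n := by
    simp [Int.negSucc_eq]
  rw [this, current]

theorem current_pos (b : ℕ+ → ℂ) (F : Sources) (m : ℕ+) :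
    current b F (m : ℤ) = MvPowerSeries.pderiv Coupling m F := by
  obtain ⟨n, rfl⟩ : ∃ n : ℕ, m = n.succPNat := ⟨m.natPred, by simp⟩
  rfl

theorem diskAmplitude_neg (b : ℕ+ → ℂ) (F : Sources) (m : ℕ+) :
    diskAmplitude b F (-(m : ℤ)) = m * b m := by
  rw [diskAmplitude, current_neg, vev, map_nsmul, map_add, MvPowerSeries.constantCoeff_C,
    MvPowerSeries.constantCoeff_X, add_zero, HahnSeries.coeff_nsmul, Pi.smul_apply,
    HahnSeries.coeff_single_same, nsmul_eq_mul]

theorem annulusAmplitude_neg (b : ℕ+ → ℂ) (F : Sources) (m n : ℕ+) :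
    annulusAmplitude b F m (-(n : ℤ)) = if n = m then (m : ℂ) else 0 := by
  classical
  rw [annulusAmplitude, vev_sourceDeriv, current_neg, map_nsmul, map_add, MvPowerSeries.coeff_C,
    if_neg (by simp), MvPowerSeries.coeff_X, zero_add]
  by_cases h : n = m
  · subst h
    rw [if_pos rfl, if_pos rfl, HahnSeries.coeff_nsmul, Pi.smul_apply, HahnSeries.coeff_one,
      if_pos rfl, nsmul_one]
  · rw [if_neg h, if_neg]
    · simp
    · intro h'
      exact h (Finsupp.single_left_injective one_ne_zero h').symm

/-- Differentiating the source in a creation operator reproduces the commutator of the oscillators.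
-/
theorem annulusAmplitude_nonpos (b : ℕ+ → ℂ) (F : Sources) {k l : ℤ} (hk : 1 ≤ k) (hl : l ≤ 0) :
    annulusAmplitude b F k l = if l = -k then (k : ℂ) else 0 := by
  obtain ⟨m, rfl⟩ : ∃ m : ℕ+, k = m := ⟨⟨k.toNat, by omega⟩, by simp only [PNat.mk_coe]; omega⟩
  rcases hl.lt_or_eq with hl | rfl
  · obtain ⟨n, rfl⟩ : ∃ n : ℕ+, l = -(n : ℤ) :=
      ⟨⟨(-l).toNat, by omega⟩, by simp only [PNat.mk_coe]; omega⟩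
    rw [annulusAmplitude_neg]
    by_cases h : n = m
    · subst h; simp
    · rw [if_neg h, if_neg]
      intro h'
      exact h (PNat.eq (by omega))
  · rw [if_neg (by omega)]
    change (vev (sourceDeriv _ 0)).coeff 0 = 0
    rw [map_zero]
    simp [vev]

/-- Both sides are mixed second derivatives of `F` at the origin. -/
theorem annulusAmplitude_symm (b : ℕ+ → ℂ) (F : Sources) {k l : ℤ} (hk : 1 ≤ k) (hl : 1 ≤ l) :
    annulusAmplitude b F k l = annulusAmplitude b F l k := by
  obtain ⟨m, rfl⟩ : ∃ m : ℕ+, k = m := ⟨⟨k.toNat, by omega⟩, by simp only [PNat.mk_coe]; omega⟩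
  obtain ⟨n, rfl⟩ : ∃ n : ℕ+, l = n := ⟨⟨l.toNat, by omega⟩, by simp only [PNat.mk_coe]; omega⟩
  classical
  rw [annulusAmplitude, annulusAmplitude, vev_sourceDeriv, vev_sourceDeriv, current_pos,
    current_pos, MvPowerSeries.coeff_pderiv, MvPowerSeries.coeff_pderiv, add_comm,
    Finsupp.single_apply, Finsupp.single_apply]
  simp only [eq_comm]

/-! ### The weak coupling limit in terms of Laurent series -/

/-- The weak coupling limit of disk and annulus amplitudes: `y` generates the disk amplitudes of
the oscillators, and `A t m` the annulus amplitudes of an oscillator and the mode `W^(t+1)_m`. -/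
theorem exists_weakCouplingLimit {p q : ℕ} (hp : 0 < p) {b : ℕ+ → ℂ}
    (hb : ∀ n : ℕ+, p + q < (n : ℕ) → b n = 0)
    (hb' : b ⟨p + q, Nat.add_pos_left hp q⟩ ≠ 0) {F : Sources} (hF : HasGenusExpansion F) :
    ∃ (y : LaurentSeries ℂ) (A : ℕ → ℤ → LaurentSeries ℂ) (c : ℕ → ℂ),
      (∀ s, c s ≠ 0) ∧ y ≠ 0 ∧ y.order = -((p + q : ℕ) : ℤ) ∧
      (∀ s n, (vev (wMode p b s n (partitionFunction F))).coeff (-(s : ℤ)) = 0 ↔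
        (y ^ s).coeff (p * n) = 0) ∧
      (∀ t m, ∀ k ≤ 0, (A t m).coeff k = 0) ∧
      (∀ k : ℕ, 1 ≤ k → ∀ (t : ℕ) (m : ℤ),
        (vev (alpha b k (wMode p b (t + 1) m (partitionFunction F))) -
          vev (alpha b k (partitionFunction F)) *
            vev (wMode p b (t + 1) m (partitionFunction F))).coeff (1 - ((t + 1 : ℕ) : ℤ)) =
          c t * (A t m).coeff k) ∧
      (∀ (s t : ℕ) (M N : ℤ),
        (connectedI p b (partitionFunction F) (s + 1) (t + 1) M N).coeff
          (2 - ((s + 1 : ℕ) : ℤ) - ((t + 1 : ℕ) : ℤ)) =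
          c s * c t * (A t (-N - ((t + 1 : ℕ) : ℤ)) * y ^ s).coeff
            (p * (-M - ((s + 1 : ℕ) : ℤ)))) ∧
      (∀ (s t : ℕ) (n m : ℤ),
        (A t m * y ^ s).coeff (p * n) - (A s n * y ^ t).coeff (p * m) =
          (euler (y ^ t) * y ^ s).coeff (p * n + p * m) -
            ((p * m : ℤ) : ℂ) * (y ^ t * y ^ s).coeff (p * n + p * m)) := by
  have hF0 := hF.1
  have hF2 := hF.mem_sourceFiltration
  have hp' : (p : ℂ) ≠ 0 := Nat.cast_ne_zero.mpr hp.ne'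
  -- The variable of `y` plays the role of `1/λ`: negative exponents carry the background, which
  -- ends at `p + q`.
  obtain ⟨y, hy⟩ := exists_laurentSeries (diskAmplitude b F) (-((p + q : ℕ) : ℤ)) (by
    intro k hk
    obtain ⟨n, rfl⟩ : ∃ n : ℕ+, k = -(n : ℤ) :=
      ⟨⟨(-k).toNat, by omega⟩, by simp only [PNat.mk_coe]; omega⟩
    rw [diskAmplitude_neg, hb n (by omega), mul_zero])
  have hlow : ∀ k < -((p + q : ℕ) : ℤ), y.coeff k = 0 := by
    intro k hk
    obtain ⟨n, rfl⟩ : ∃ n : ℕ+, k = -(n : ℤ) :=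
      ⟨⟨(-k).toNat, by omega⟩, by simp only [PNat.mk_coe]; omega⟩
    rw [hy, diskAmplitude_neg, hb n (by omega), mul_zero]
  have hlead : y.coeff (-((p + q : ℕ) : ℤ)) ≠ 0 := by
    have := diskAmplitude_neg b F ⟨p + q, Nat.add_pos_left hp q⟩
    simp only [PNat.mk_coe] at this
    rw [hy, this]
    exact mul_ne_zero (Nat.cast_ne_zero.mpr (by omega)) hb'
  have hG : ∀ k : ℤ, ∃ X : LaurentSeries ℂ, ∀ l, X.coeff l =
      if 1 ≤ k then annulusAmplitude b F k l else 0 := by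
    intro k
    refine exists_laurentSeries _ (-max k 0) fun l hl => ?_
    split_ifs with hk
    · rw [annulusAmplitude_nonpos b F hk (by omega), if_neg (by omega)]
    · rfl
  choose G hG using hG
  have hA : ∀ (t : ℕ) (m : ℤ), ∃ X : LaurentSeries ℂ, ∀ k, X.coeff k =
      if 1 ≤ k then (G k * y ^ t).coeff (p * m) else 0 :=
    fun t m => exists_laurentSeries _ 1 fun k hk => if_neg (by omega)
  choose A hA using hA
  have hann : ∀ (t : ℕ) (m : ℤ) (k : ℤ),
      (vev (sourceDeriv k (modeSeries p b F (t + 1) m))).coeff (1 - ((t + 1 : ℕ) : ℤ)) =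
        p * ((p : ℂ) ^ (t + 1))⁻¹ * (t + 1) * (A t m).coeff k := by
    intro t m k
    rw [hA]
    split_ifs with hk
    · obtain ⟨n, rfl⟩ : ∃ n : ℕ+, k = n := ⟨⟨k.toNat, by omega⟩, by simp only [PNat.mk_coe]; omega⟩
      rw [vev_sourceDeriv_modeSeries hp hb hF2]
      have hGn : ∀ l, annulusAmplitude b F n l = (G n).coeff l := fun l => by
        rw [hG, if_pos hk]
      simp only [← hy, hGn]
      rw [finsum_sum_prod_coeff]
      ring
    · rw [sourceDeriv_of_nonpos (by omega)]
      simp [vev]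
  refine ⟨y, A, fun s => p * ((p : ℂ) ^ (s + 1))⁻¹ * (s + 1), ?_, ?_, ?_, ?_, ?_, ?_, ?_, ?_⟩
  · intro s
    have : (s : ℂ) + 1 ≠ 0 := Nat.cast_add_one_ne_zero s
    positivity
  · rintro rfl
    exact hlead rfl
  · refine le_antisymm (HahnSeries.order_le_of_coeff_ne_zero hlead) ?_
    by_contra! h
    refine HahnSeries.coeff_order_eq_zero.not.mpr ?_ (hlow _ h)
    rintro rfl
    exact hlead rfl
  · intro s n
    rw [wMode_partitionFunction p hb hF0, vev_mul_partitionFunction hF0,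
      vev_modeSeries hp hb hF2]
    simp only [← hy]
    rw [finsum_prod_coeff, mul_eq_zero, or_iff_right]
    positivity
  · intro t m k hk
    rw [hA, if_neg (by omega)]
  · intro k hk t m
    rw [alpha_connected_eq p hb hF0, hann]
  · intro s t M N
    rw [connectedI_eq p hb hF0]
    have h := vev_dressedMode_connected hp hb hF2 (s + 1) (-M - ((s + 1 : ℕ) : ℤ))
      (modeSeries_mem p hb hF2 (t + 1) (-N - ((t + 1 : ℕ) : ℤ)))
    have e1 : -((t + 1 : ℕ) : ℤ) - ((s + 1 : ℕ) : ℤ) + 2 =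
      2 - ((s + 1 : ℕ) : ℤ) - ((t + 1 : ℕ) : ℤ) := by ring
    have e2 : -((t + 1 : ℕ) : ℤ) + 1 = 1 - ((t + 1 : ℕ) : ℤ) := by ring
    rw [e1, e2] at h
    rw [h]
    simp only [← hy, hann]
    -- The constant of the inner mode is absorbed into the marked series, so that the convolution
    -- formula applies directly.
    have h3 := finsum_sum_prod_coeff (r := s) (p * (-M - ((s + 1 : ℕ) : ℤ)))
      (HahnSeries.C (p * ((p : ℂ) ^ (t + 1))⁻¹ * (t + 1)) * A t (-N - ((t + 1 : ℕ) : ℤ))) y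
    rw [mul_assoc (HahnSeries.C _)] at h3
    simp only [HahnSeries.C_mul_eq_smul, HahnSeries.coeff_smul, smul_eq_mul] at h3
    rw [h3]
    ring
  · intro s t n m
    refine pairing_sub_pairing (G := G) ?_ ?_ (hA t m) (hA s n)
    · intro k hk l hl
      rw [hG, if_pos hk, annulusAmplitude_nonpos b F hk hl]
    · intro k l hk hl
      rw [hG, hG, if_pos hk, if_pos hl, annulusAmplitude_symm b F hk hl]

/-! ### Equivalence with the disk and annulus constraints -/

theorem forall_W1_and_W2_iff (p : ℕ) (b : ℕ+ → ℂ) (Z : Sources) :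
    (∀ s t : ℕ, 1 ≤ s → 1 ≤ t → ConditionW1 p b Z s t ∧ ConditionW2 p b Z s t) ↔
      ∀ s t : ℕ, ConditionW1 p b Z (s + 1) (t + 1) := by
  refine ⟨fun h s t => (h _ _ (by omega) (by omega)).1, fun h s t hs ht => ?_⟩
  obtain ⟨s, rfl⟩ := Nat.exists_eq_add_of_le' hs
  obtain ⟨t, rfl⟩ := Nat.exists_eq_add_of_le' ht
  refine ⟨h s t, fun M N hMN => ?_⟩
  rw [connectedII_eq_connectedI, sub_right_comm]
  exact h t s N M (by omega)

theorem forall_W1_iff_disk_and_annulus {p q : ℕ} (hp : 0 < p) (hpq : p.Coprime q) {b : ℕ+ → ℂ}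
    (hb : ∀ n : ℕ+, p + q < (n : ℕ) → b n = 0)
    (hb' : b ⟨p + q, Nat.add_pos_left hp q⟩ ≠ 0) {F : Sources} (hF : HasGenusExpansion F) :
    (∀ s t : ℕ, ConditionW1 p b (partitionFunction F) (s + 1) (t + 1)) ↔
      DiskConstraints p b (partitionFunction F) ∧ AnnulusConstraints p b (partitionFunction F) := by
  obtain ⟨y, A, c, hc, hy0, hyo, hdisk, hA0, hann, hconn, hcomm⟩ :=
    exists_weakCouplingLimit hp hb hb' hF
  have hpZ : (p : ℂ) ≠ 0 := Nat.cast_ne_zero.mpr hp.ne'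
  have hcomm' : ∀ (s t : ℕ) (n m : ℤ), ((t : ℂ) + s) *
      ((A t m * y ^ s).coeff (p * n) - (A s n * y ^ t).coeff (p * m)) =
      p * (t * n - s * m) * (y ^ (t + s)).coeff (p * (n + m)) := by
    intro s t n m
    have h := congrArg (fun x : LaurentSeries ℂ => x.coeff (p * n + p * m))
      (add_smul_euler_pow_mul y t s)
    have hcast : ∀ n : ℕ, (n : LaurentSeries ℂ) = HahnSeries.C (n : ℂ) := fun n =>
      (map_natCast HahnSeries.C n).symm
    rw [hcast, hcast, ← map_add, HahnSeries.C_mul_eq_smul, HahnSeries.C_mul_eq_smul, HahnSeries.coeff_smul,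
      HahnSeries.coeff_smul, coeff_euler, smul_eq_mul, smul_eq_mul] at h
    rw [hcomm, mul_sub, h, ← pow_add, mul_add (p : ℤ) n m]
    push_cast
    ring
  -- With `M = -n - s - 1` and `N = -m - t - 1`, the inequality `N < 0` reads `-t ≤ m`, and `M + N <
  -- -2` reads `1 - s - t ≤ n + m`.
  have hW : (∀ s t : ℕ, ConditionW1 p b (partitionFunction F) (s + 1) (t + 1)) ↔
      ∀ (s t : ℕ) (n m : ℤ), -(t : ℤ) ≤ m ∨ 1 - (s : ℤ) - t ≤ n + m →
        (A t m * y ^ s).coeff (p * n) = 0 := by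
    constructor
    · intro h s t n m hnm
      have h1 := h s t (-n - ((s + 1 : ℕ) : ℤ)) (-m - ((t + 1 : ℕ) : ℤ)) (by push_cast; omega)
      rw [hconn, mul_eq_zero, or_iff_right (mul_ne_zero (hc s) (hc t))] at h1
      convert h1 using 3 <;> ring_nf
    · intro h s t M N hMN
      rw [hconn, h, mul_zero]
      push_cast
      omega
  have hD : DiskConstraints p b (partitionFunction F) ↔
      ∀ s : ℕ, 1 ≤ s → ∀ n : ℤ, 1 - (s : ℤ) ≤ n → (y ^ s).coeff (p * n) = 0 := by
    simp only [DiskConstraints, hdisk]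
  have hAnn : AnnulusConstraints p b (partitionFunction F) ↔
      ∀ (t : ℕ) (m : ℤ), -(t : ℤ) ≤ m → A t m = 0 := by
    constructor
    · intro h t m hm
      ext k
      rw [HahnSeries.coeff_zero]
      rcases le_or_gt k 0 with hk | hk
      · exact hA0 t m k hk
      · have h1 := h k.toNat (by omega) (t + 1) (by omega) m (by push_cast; omega)
        rw [hann _ (by omega), mul_eq_zero, or_iff_right (hc t)] at h1
        rwa [Int.toNat_of_nonneg hk.le] at h1
    · intro h k hk t ht m hm
      obtain ⟨t, rfl⟩ := Nat.exists_eq_add_of_le' ht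
      rw [hann k hk, h t m (by push_cast at hm; omega), HahnSeries.coeff_zero, mul_zero]
  rw [hW, hD, hAnn]
  constructor
  · intro h
    refine ⟨fun s hs n hn => ?_, fun t m hm => ?_⟩
    · have h1 := hcomm' s 0 (n - 1) 1
      have hs' : (s : ℂ) ≠ 0 := Nat.cast_ne_zero.mpr (by omega)
      rw [h s 0 (n - 1) 1 (by omega), h 0 s 1 (n - 1) (by push_cast; omega), sub_self, mul_zero,
        zero_add, sub_add_cancel] at h1
      refine (mul_eq_zero.mp h1.symm).resolve_left ?_
      simp [hs', hpZ]
    · refine eq_zero_of_forall_coeff_mul_pow hp (Nat.coprime_self_add_right.mpr hpq) hyo hy0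
        fun j n => h j t n m (Or.inl hm)
  · rintro ⟨hD, hA⟩ s t n m hnm
    by_cases hm : -(t : ℤ) ≤ m
    · rw [hA t m hm, zero_mul, HahnSeries.coeff_zero]
    have hnm := hnm.resolve_left hm
    -- If `m < -t`, the bound on `n + m` forces `n ≥ 2 - s`. The opposite ordering then vanishes by
    -- the annulus constraints, leaving the commutator to the disk constraints.
    have hn : A s n = 0 := hA s n (by omega)
    rcases Nat.eq_zero_or_pos (t + s) with h0 | h0
    -- For two currents `W¹` the commutator is a central term supported at `n + m = 0`, which the
    -- inequality excludes.
    · obtain ⟨rfl, rfl⟩ : t = 0 ∧ s = 0 := by omega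
      have h1 := hcomm 0 0 n m
      have hpos : (p : ℤ) * n + p * m ≠ 0 := by
        rw [← mul_add]
        exact mul_ne_zero (by omega) (by push_cast at hnm; omega)
      rw [hn, zero_mul, HahnSeries.coeff_zero, sub_zero] at h1
      rw [h1]
      simp [euler_one, HahnSeries.coeff_one, hpos]
    · have h1 := hcomm' s t n m
      rw [hn, zero_mul, HahnSeries.coeff_zero, sub_zero,
        hD (t + s) h0 (n + m) (by push_cast; omega), mul_zero] at h1
      refine (mul_eq_zero.mp h1).resolve_left ?_
      exact_mod_cast h0.ne'

/-! ### Consequences of the exact constraints -/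

theorem wMode_zero (p : ℕ) (b : ℕ+ → ℂ) (s : ℕ) (n : ℤ) : wMode p b s n 0 = 0 := by
  ext1 J
  change ∑ r ∈ Finset.range (s + 1), ∑ᶠ k ∈ {k : Fin r → ℤ | ∑ i, k i = p * n},
    HahnSeries.C (modeWeight p s k) * MvPowerSeries.coeff J (normalOrdered b k 0) = _
  simp

/-- In the region (I) the second current acts first. For `N < 0` its mode index `-N - t` is at least
`1 - t`, so it annihilates the state, to all orders in `g`. -/
theorem connectedI_eq_zero_of_constraints {p : ℕ} {b : ℕ+ → ℂ} {Z : Sources}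
    (h : WConstraints p b Z) (s : ℕ) {t : ℕ} (ht : 1 ≤ t) (M : ℤ) {N : ℤ} (hN : N < 0) :
    connectedI p b Z s t M N = 0 := by
  rw [connectedI, h t ht (-N - t) (by omega), wMode_zero]
  simp [vev]

theorem disk_and_annulus_of_constraints {p : ℕ} {b : ℕ+ → ℂ} {Z : Sources}
    (h : WConstraints p b Z) : DiskConstraints p b Z ∧ AnnulusConstraints p b Z := by
  refine ⟨fun s hs n hn => ?_, fun k _ t ht n hn => ?_⟩
  · rw [h s hs n hn]
    simp [vev]
  · rw [h t ht n hn]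
    simp [vev]

end MinimalString

end

open MinimalString in
theorem proposition5 (p q : ℕ) (hp : 0 < p) (hpq : p.Coprime q) (b : ℕ+ → ℂ)
    (hb : ∀ n : ℕ+, p + q < (n : ℕ) → b n = 0)
    (hb' : b ⟨p + q, Nat.add_pos_left hp q⟩ ≠ 0)
    (F : Sources) (hF : HasGenusExpansion F) :
    (WConstraints p b (partitionFunction F) →
      ∀ s t : ℕ, 1 ≤ s → 1 ≤ t →
        (∀ M N : ℤ, N < 0 → connectedI p b (partitionFunction F) s t M N = 0) ∧
        (∀ M N : ℤ, M < 0 → connectedII p b (partitionFunction F) s t M N = 0) ∧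
        ConditionW1 p b (partitionFunction F) s t ∧
        ConditionW2 p b (partitionFunction F) s t) ∧
    ((∀ s t : ℕ, 1 ≤ s → 1 ≤ t →
        ConditionW1 p b (partitionFunction F) s t ∧
        ConditionW2 p b (partitionFunction F) s t) ↔
      DiskConstraints p b (partitionFunction F) ∧
      AnnulusConstraints p b (partitionFunction F)) := by
  have hiff := (forall_W1_and_W2_iff p b (partitionFunction F)).trans
    (forall_W1_iff_disk_and_annulus hp hpq hb hb' hF)
  refine ⟨fun h s t hs ht => ⟨fun M N hN => connectedI_eq_zero_of_constraints h s ht M hN,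
    fun M N hM => ?_, hiff.mpr (disk_and_annulus_of_constraints h) s t hs ht⟩, hiff⟩
  rw [connectedII_eq_connectedI]
  exact connectedI_eq_zero_of_constraints h t hs N hM
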